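/- Let $d\ge 2$ and let $\Omega\subset\mathbb{R}^d$ be open, bounded and connected with $C^3$ boundary. Let $\rho\in C^2(\overline\Omega)$ be a probability density on $\Omega$ with $0<\inf_\Omega\rho\le\sup_\Omega\rho<\infty$. Let $\eta:[0,\infty)\to[0,\infty)$ be non-increasing and continuous at $0$, with $\eta(t)\ge 1$ for $t\le 1$ and $\eta(t)=0$ for $t\ge 2$; put $\eta_\varepsilon(t)=\varepsilon^{-d}\eta(t/\varepsilon)$ and $\sigma_\eta=\int_{\mathbb{R}^d}\eta(|z|)z_1^2\,dz$. For $x\in\Omega$ let $\delta_x=\operatorname{dist}(x,\partial\Omega)$. Let $\bm{n}$ be a $C^2$ extension to $\Omega$ of the outward unit normal on $\partial\Omega$ such that, for some $r>0$, $\bm{n}(x)=\bm{n}(y_x)$ whenever $\delta_x\le r$, where $y_x$ is the point of $\partial\Omega$ nearest to $x$; write $\frac{\partial}{\partial\bm{n}}=\bm{n}\cdot\nabla$. For $\varepsilon>0$ and $t\ge 0$ define \[ \mathcal{L}_\varepsilon u(x)=\frac{2}{\varepsilon^2}\int_\Omega\eta_\varepsilon(|x-y|)\,(u(x)-u(y))\,\rho(y)\,dy,\qquad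 \mathcal{L}u(x)=-\frac{\sigma_\eta}{\rho(x)}\operatorname{div}(\rho^2\nabla u)(x), \] \[ \gamma_\varepsilon(x)=\frac1\varepsilon\int_{B(x,2\varepsilon)\cap\Omega}\eta_\varepsilon(|x-y|)\,(x-y)\cdot\bm{n}(x)\,dy, \] \[ \sigma_1(t)=\int_{B(0,2)\cap\{z_d>-t\}}\eta(|z|)\,z_1^2\,dz,\qquad \sigma_2(t)=\int_{B(0,2)\cap\{z_d>-t\}}\eta(|z|)\,(z_d^2-z_1^2)\,dz . \] Then there exists $C>0$, depending only on $d$, $\Omega$, $\rho$, $\eta$ and the chosen extension $\bm{n}$, such that for every $\varepsilon>0$ and every $\varphi\in C^3(\overline\Omega)$, \[ \sup_{x\in\Omega}\left|\mathcal{L}_\varepsilon\varphi(x)-\frac{\sigma_1(\delta_x/\varepsilon)}{\sigma_\eta}\mathcal{L}\varphi(x)-\frac{2\rho(x)\gamma_\varepsilon(x)}{\varepsilon}\frac{\partial\varphi}{\partial\bm{n}}(x)+\frac{\sigma_2(\delta_x/\varepsilon)}{\rho(x)}\frac{\partial}{\partial\bm{n}}\left(\rho^2\frac{\partial\varphi}{\partial\bm{n}}\right)(x)\right|\le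 C\,\varepsilon\,\|\varphi\|_{C^3(\overline\Omega)} . \] -/

import Mathlib

namespace NonlocalLaplacian

noncomputable section

/-- Euclidean space `ℝ^d`. -/
abbrev Space (d : ℕ) : Type := EuclideanSpace ℝ (Fin d)

/-! ### Domains with `C^k` boundary and the outward unit normal -/

/-- The function whose negativity set is the open region strictly above the graph of `F` in the
direction of the unit vector `ν`. Here `F` is a function on the hyperplane `ν^⊥`; it is represented
by a function on `ℝ^d` which is only evaluated at the orthogonal projection `y - ⟨ν, y⟩ ν`. -/
def graphFun {d : ℕ} (ν : Space d) (F : Space d → ℝ) (y : Space d) : ℝ :=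
  F (y - (inner ℝ ν y) • ν) - inner ℝ ν y

/-- In the ball `B(p, r)` the set `Ω` is the region above the graph of a `C^k` function `F` over
the hyperplane `ν^⊥`: `Ω ∩ B(p, r) = {y ∈ B(p, r) : ⟨ν, y⟩ > F (y - ⟨ν, y⟩ ν)}`. -/
structure IsLocalGraph {d : ℕ} (k : ℕ) (Ω : Set (Space d)) (p ν : Space d)
    (F : Space d → ℝ) (r : ℝ) : Prop where
  norm_eq_one : ‖ν‖ = 1
  radius_pos : 0 < r
  contDiff : ContDiff ℝ k F
  mem_iff : ∀ y ∈ Metric.ball p r, y ∈ Ω ↔ graphFun ν F y < 0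

/-- `Ω` has `C^k` boundary: near each boundary point it is, after a rotation of the coordinates,
the region above the graph of a `C^k` function. -/
def HasCkBoundary {d : ℕ} (k : ℕ) (Ω : Set (Space d)) : Prop :=
  ∀ p ∈ frontier Ω, ∃ (ν : Space d) (F : Space d → ℝ) (r : ℝ), IsLocalGraph k Ω p ν F r

/-- `v` is the outward unit normal to `Ω` at the boundary point `p`: the normalized gradient at `p`
of a local defining function of `Ω` (negative exactly in `Ω`) given by a `C^1` graph. The gradient
does not vanish, its component along `ν` being `-1`. -/
def IsOutwardUnitNormal {d : ℕ} (Ω : Set (Space d)) (p v : Space d) : Prop :=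
  ∃ (ν : Space d) (F : Space d → ℝ) (r : ℝ), IsLocalGraph 1 Ω p ν F r ∧
    v = ‖gradient (graphFun ν F) p‖⁻¹ • gradient (graphFun ν F) p

/-- The distance `δ_x` of `x` to the boundary of `Ω`. -/
def bdryDist {d : ℕ} (Ω : Set (Space d)) (x : Space d) : ℝ :=
  Metric.infDist x (frontier Ω)

/-- `n` is a `C^2` extension to `Ω` of the outward unit normal on `∂Ω` such that, for some `r > 0`,
`n x = n y` whenever `x ∈ Ω` has distance at most `r` to `∂Ω` and `y` is the nearest boundary
point to `x`. -/
structure IsNormalExtension {d : ℕ} (Ω : Set (Space d)) (n : Space d → Space d) : Prop where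
  contDiffOn : ContDiffOn ℝ 2 n Ω
  outward : ∀ p ∈ frontier Ω, IsOutwardUnitNormal Ω p (n p)
  eq_nearest : ∃ r > 0, ∀ x ∈ Ω, bdryDist Ω x ≤ r →
    ∀ y ∈ frontier Ω, dist x y = bdryDist Ω x → n x = n y

/-! ### The spaces `C^k` on the closure of `Ω` -/

/-- `f ∈ C^k(closure Ω)` for an open set `Ω`: `f` is `C^k` in `Ω`, and its derivatives of order at
most `k` extend continuously to the closure of `Ω`. -/
def IsCkClosure {d : ℕ} (k : ℕ) (Ω : Set (Space d)) (f : Space d → ℝ) : Prop :=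
  ContDiffOn ℝ k f Ω ∧ ∀ m ≤ k, ∃ g : Space d → ContinuousMultilinearMap ℝ
    (fun _ : Fin m => Space d) ℝ,
      ContinuousOn g (closure Ω) ∧ Set.EqOn (iteratedFDeriv ℝ m f) g Ω

/-- The norm of `C^k(closure Ω)`: the sum over `m ≤ k` of `sup_Ω ‖D^m f‖`. -/
def ckNorm {d : ℕ} (k : ℕ) (Ω : Set (Space d)) (f : Space d → ℝ) : ℝ :=
  ∑ m ∈ Finset.range (k + 1), ⨆ x : Ω, ‖iteratedFDeriv ℝ m f (x : Space d)‖

/-! ### Standing assumptions on the domain, the density and the kernel -/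

/-- `Ω ⊂ ℝ^d` is open, bounded and connected with `C^3` boundary. -/
structure IsAdmissibleDomain {d : ℕ} (Ω : Set (Space d)) : Prop where
  isOpen : IsOpen Ω
  isBounded : Bornology.IsBounded Ω
  isConnected : IsConnected Ω
  boundary : HasCkBoundary 3 Ω

/-- `ρ` is a probability density on `Ω` of class `C^2(closure Ω)`, bounded below and above by
positive constants. The upper bound is automatic, `Ω` being bounded. -/
structure IsAdmissibleDensity {d : ℕ} (Ω : Set (Space d)) (ρ : Space d → ℝ) : Prop where
  ck : IsCkClosure 2 Ω ρ
  lower : ∃ ρmin > 0, ∀ x ∈ Ω, ρmin ≤ ρ x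
  integral_eq_one : ∫ x in Ω, ρ x = 1

/-- The interaction potential `η : [0, ∞) → [0, ∞)` (values at negative arguments are never used)
is non-increasing, continuous at `0`, at least `1` on `[0, 1]`, and vanishes on `[2, ∞)`. -/
structure IsKernel (η : ℝ → ℝ) : Prop where
  nonneg : ∀ t, 0 ≤ t → 0 ≤ η t
  antitoneOn : AntitoneOn η (Set.Ici 0)
  continuous_zero : ContinuousWithinAt η (Set.Ici 0) 0
  one_le : ∀ t, 0 ≤ t → t ≤ 1 → 1 ≤ η t
  eq_zero : ∀ t, 2 ≤ t → η t = 0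

/-! ### Kernel quantities -/

/-- The index of the first coordinate of `ℝ^d`. -/
def firstIdx {d : ℕ} (hd : 2 ≤ d) : Fin d := ⟨0, by omega⟩

/-- The index of the last coordinate of `ℝ^d`. -/
def lastIdx {d : ℕ} (hd : 2 ≤ d) : Fin d := ⟨d - 1, by omega⟩

/-- The rescaled kernel `η_ε(t) = ε^{-d} η(t / ε)`. -/
def etaEps (d : ℕ) (η : ℝ → ℝ) (ε t : ℝ) : ℝ := 1 / ε ^ d * η (t / ε)

/-- `σ_η = ∫_{ℝ^d} η(|z|) z_1^2 dz`. -/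
def sigmaEta {d : ℕ} (hd : 2 ≤ d) (η : ℝ → ℝ) : ℝ :=
  ∫ z : Space d, η ‖z‖ * z (firstIdx hd) ^ 2

/-- `σ_1(t)`, the integral of `η(|z|) z_1^2` over `B(0, 2) ∩ {z_d > -t}`. -/
def sigma1 {d : ℕ} (hd : 2 ≤ d) (η : ℝ → ℝ) (t : ℝ) : ℝ :=
  ∫ z in Metric.ball (0 : Space d) 2 ∩ {z : Space d | -t < z (lastIdx hd)},
    η ‖z‖ * z (firstIdx hd) ^ 2

/-- `σ_2(t)`, the integral of `η(|z|) (z_d^2 - z_1^2)` over `B(0, 2) ∩ {z_d > -t}`. -/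
def sigma2 {d : ℕ} (hd : 2 ≤ d) (η : ℝ → ℝ) (t : ℝ) : ℝ :=
  ∫ z in Metric.ball (0 : Space d) 2 ∩ {z : Space d | -t < z (lastIdx hd)},
    η ‖z‖ * (z (lastIdx hd) ^ 2 - z (firstIdx hd) ^ 2)

/-- `γ_ε(x) = ε^{-1} ∫_{B(x, 2ε) ∩ Ω} η_ε(|x - y|) (x - y) · n(x) dy`. -/
def gammaEps {d : ℕ} (Ω : Set (Space d)) (η : ℝ → ℝ) (n : Space d → Space d) (ε : ℝ)
    (x : Space d) : ℝ :=
  1 / ε * ∫ y in Metric.ball x (2 * ε) ∩ Ω, etaEps d η ε ‖x - y‖ * inner ℝ (x - y) (n x)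

/-! ### Differential and integral operators -/

/-- The divergence of a vector field on `ℝ^d`. -/
def divergence {d : ℕ} (V : Space d → Space d) (x : Space d) : ℝ :=
  ∑ i : Fin d, (fderiv ℝ V x (EuclideanSpace.single i 1)) i

/-- The derivative `∂u/∂n = n · ∇u` in the direction of the vector field `n`. -/
def normalDeriv {d : ℕ} (n : Space d → Space d) (u : Space d → ℝ) (x : Space d) : ℝ :=
  inner ℝ (n x) (gradient u x)

/-- The nonlocal Laplacian `2 ε^{-2} ∫_Ω η_ε(|x - y|) (u(x) - u(y)) ρ(y) dy`. -/
def nonlocalLaplacian {d : ℕ} (Ω : Set (Space d)) (ρ : Space d → ℝ) (η : ℝ → ℝ) (ε : ℝ)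
    (u : Space d → ℝ) (x : Space d) : ℝ :=
  2 / ε ^ 2 * ∫ y in Ω, etaEps d η ε ‖x - y‖ * (u x - u y) * ρ y

/-- The weighted Laplacian `-(σ_η / ρ) div (ρ^2 ∇u)`. -/
def weightedLaplacian {d : ℕ} (hd : 2 ≤ d) (ρ : Space d → ℝ) (η : ℝ → ℝ)
    (u : Space d → ℝ) (x : Space d) : ℝ :=
  -(sigmaEta hd η / ρ x) * divergence (fun y => ρ y ^ 2 • gradient u y) x

end

end NonlocalLaplacian

/-! Substitute `y = x + ε z` and let `D = blowup Ω ε x`. Taylor expansion gives `(φ x - φ y) ρ y =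
-ε ρ(x) ℓ z - ε² Q(z, z) + O(ε³)`, with `ℓ = Dφ(x)` and `Q = ∇φ ⊗ ∇ρ + ½ ρ D²φ` (`secondOrderForm`).
After multiplication by `2/ε²` the remainder is `O(ε)`, so only the first and second moments of the
kernel over `D` matter. Since `Ω` need not be convex, the expansion runs along polygonal paths in
`Ω` of length at most `K |y - x|`.

Second moments: `D` differs from a half ball by a layer of thickness `O(ε)`. Over a half ball with
normal `v`, symmetry gives exactly `σ₁ tr Q + σ₂ Q(v, v)` (`integral_halfBall_bilin`). Here `div (ρ²
∇φ) = 2 ρ tr Q`, while `∂ₙ(ρ² ∂ₙφ) = 2 ρ Q(n, n) + ρ² ℓ(Dn n)`. The last term is harmless: near the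
boundary `n` is constant along normals, so `Dn n = 0`, and `σ₂ = 0` as soon as `δ ≥ 2 ε`.

First moments carry a factor `1/ε`, so they are needed up to `O(ε²)`. The normal part is exactly the
`γ` term. The tangential part is odd under the reflection fixing the normal line and negating the
tangent plane. The boundary is the zero set of `a s + B(w, w) + O(ε³)`, where `s` is the normal
component of the displacement `w`, and `B(w, w)` is even. Reflection keeps `s` and changes `B(w, w)`
only by `O(ε |s|)`. Since `s = O(ε²)` at the boundary, `D` and its reflection differ by a layer of
thickness `O(ε²)` (`blowup_estimates`).

These facts are collected in `LocalEstimates` for small `ε`. For `ε` bounded below, every term is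
bounded by a constant times the norm of `φ`. -/

namespace NonlocalLaplacian

open MeasureTheory Metric Set

variable {d : ℕ}

/-! ### Kernel bounds, volumes of slabs, and rescaling -/

namespace IsKernel

variable {η : ℝ → ℝ}

lemma le_zero (hη : IsKernel η) {t : ℝ} (ht : 0 ≤ t) : η t ≤ η 0 :=
  hη.antitoneOn (by simp) ht ht

lemma zero_pos (hη : IsKernel η) : 0 < η 0 :=
  lt_of_lt_of_le one_pos (hη.one_le 0 le_rfl zero_le_one)

lemma abs_norm_le (hη : IsKernel η) (z : Space d) : |η ‖z‖| ≤ η 0 := by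
  rw [abs_of_nonneg (hη.nonneg _ (norm_nonneg z))]
  exact hη.le_zero (norm_nonneg z)

lemma measurable_norm (hη : IsKernel η) : Measurable fun z : Space d => η ‖z‖ := by
  -- Monotonicity is known on `[0, ∞)` only; truncation at `0` makes it global, and monotone
  -- functions are measurable.
  have h : Antitone fun t : ℝ => η (max t 0) := fun a b hab =>
    hη.antitoneOn (by simp) (by simp) (max_le_max_right 0 hab)
  have h2 : (fun z : Space d => η ‖z‖) = (fun t : ℝ => η (max t 0)) ∘ fun z : Space d => ‖z‖ := by
    ext z; simp
  rw [h2]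
  exact h.measurable.comp _root_.measurable_norm

lemma integrableOn_mul (hη : IsKernel η) {g : Space d → ℝ} (hg : Continuous g) :
    IntegrableOn (fun z => η ‖z‖ * g z) (ball 0 2) := by
  have hg2 : IntegrableOn g (ball (0 : Space d) 2) :=
    (hg.continuousOn.integrableOn_compact (isCompact_closedBall _ _)).mono_set
      ball_subset_closedBall
  exact Integrable.bdd_mul (c := η 0) hg2 hη.measurable_norm.aestronglyMeasurable
    (Filter.Eventually.of_forall fun z => hη.abs_norm_le z)

end IsKernel

/-- The volume of a slab about a graph over the hyperplane orthogonal to `ν` is at most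
proportional to its thickness. -/
lemma exists_volume_slab_le (d : ℕ) : ∃ C : ℝ, 0 < C ∧ ∀ (ν : Space d) (G : Space d → ℝ),
    ‖ν‖ = 1 → Continuous G → (∀ y u, G (y + u • ν) = G y - u) → ∀ t : ℝ, 0 < t →
      volume.real {z | z ∈ ball (0 : Space d) 2 ∧ |G z| ≤ t} ≤ C * t := by
  refine ⟨volume.real (ball (0 : Space d) 8), ?_, ?_⟩
  · exact ENNReal.toReal_pos (measure_ball_pos _ _ (by norm_num)).ne' measure_ball_lt_top.ne
  intro ν G hν hG hGν t ht
  set A : Set (Space d) := {z | z ∈ ball (0 : Space d) 2 ∧ |G z| ≤ t} with hA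
  -- For `t > 1` the volume of the ball already suffices. Otherwise about `1/t` disjoint translates
  -- of the slab fit into a fixed ball.
  rcases le_or_gt t 1 with h1 | h1
  swap
  · have : volume.real A ≤ volume.real (ball (0 : Space d) 8) := by
      refine measureReal_mono ?_ measure_ball_lt_top.ne
      intro z hz
      exact ball_subset_ball (by norm_num) hz.1
    nlinarith [measureReal_nonneg (μ := volume) (s := A)]
  have hAm : MeasurableSet A :=
    measurableSet_ball.inter (measurableSet_le hG.abs.measurable measurable_const)
  set N : ℕ := ⌈1 / t⌉₊ with hN
  have hN1 : 1 / t ≤ N := Nat.le_ceil _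
  have hN2 : (N : ℝ) < 1 / t + 1 := Nat.ceil_lt_add_one (by positivity)
  -- On the translate `T k` the values of `G` lie in a window of width `2 t` about `-3 t k`, so
  -- distinct translates are disjoint. The shifts stay below `3` because `t k ≤ 1`.
  let T : ℕ → Set (Space d) := fun k => (fun z => z + (-(3 * t * k)) • ν) ⁻¹' A
  have hTm : ∀ k, MeasurableSet (T k) := fun k => hAm.preimage (by fun_prop)
  have hTv : ∀ k, volume.real (T k) = volume.real A := by
    intro k
    simp only [T, Measure.real, measure_preimage_add_right]
  have hdisj : ∀ j k, j < k → Disjoint (T j) (T k) := by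
    intro j k hjk
    rw [Set.disjoint_left]
    intro z hz hz'
    have a1 := hz.2
    have a2 := hz'.2
    simp only [hGν] at a1 a2
    rw [abs_le] at a1 a2
    have : (j : ℝ) + 1 ≤ k := by exact_mod_cast hjk
    nlinarith
  have hpd : ((Finset.range N : Finset ℕ) : Set ℕ).PairwiseDisjoint T := by
    intro j _ k _ hjk
    rcases lt_or_gt_of_ne hjk with h | h
    · exact hdisj j k h
    · exact (hdisj k j h).symm
  have hsub : (⋃ k ∈ Finset.range N, T k) ⊆ ball (0 : Space d) 8 := by
    intro z hz
    simp only [Set.mem_iUnion, Finset.mem_range] at hz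
    obtain ⟨k, hk, hz⟩ := hz
    have a1 := hz.1
    rw [mem_ball_zero_iff] at a1 ⊢
    have hk' : (k : ℝ) + 1 ≤ N := by exact_mod_cast hk
    have a2 : ‖z‖ ≤ ‖z + (-(3 * t * k)) • ν‖ + ‖(3 * t * k) • ν‖ := by
      calc ‖z‖ = ‖(z + (-(3 * t * k)) • ν) + (3 * t * k) • ν‖ := by
            congr 1; module
        _ ≤ _ := norm_add_le _ _
    rw [norm_smul, hν, mul_one, Real.norm_of_nonneg (by positivity)] at a2
    have a3 : t * k ≤ 1 := by
      have : t * k ≤ t * (1 / t) := by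
        apply mul_le_mul_of_nonneg_left _ ht.le
        linarith
      rwa [mul_one_div_cancel ht.ne'] at this
    linarith
  have hsum : (N : ℝ) * volume.real A ≤ volume.real (ball (0 : Space d) 8) := by
    calc (N : ℝ) * volume.real A = ∑ k ∈ Finset.range N, volume.real (T k) := by
          simp [hTv]
      _ = volume.real (⋃ k ∈ Finset.range N, T k) := by
          refine (measureReal_biUnion_finset hpd (fun k _ => hTm k) ?_).symm
          intro k _
          simp only [T, measure_preimage_add_right]
          exact (lt_of_le_of_lt (measure_mono fun z hz => hz.1) measure_ball_lt_top).ne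
      _ ≤ _ := measureReal_mono hsub measure_ball_lt_top.ne
  have h2 : 1 / t * volume.real A ≤ volume.real (ball (0 : Space d) 8) :=
    le_trans (mul_le_mul_of_nonneg_right hN1 measureReal_nonneg) hsum
  rw [one_div, inv_mul_le_iff₀ ht] at h2
  linarith

/-- Two integrals of a bounded function differ at most by a multiple of the volume of a set
containing the symmetric difference of the domains. -/
lemma abs_setIntegral_sub_le {f : Space d → ℝ} {B S T A : Set (Space d)} {M : ℝ}
    (hf : IntegrableOn f B) (hS : MeasurableSet S) (hT : MeasurableSet T) (hSB : S ⊆ B)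
    (hTB : T ⊆ B) (hA : volume A ≠ ⊤) (hM : ∀ z ∈ B, |f z| ≤ M)
    (hST : ∀ z ∈ B, ¬ (z ∈ S ↔ z ∈ T) → z ∈ A) (hM0 : 0 ≤ M) :
    |(∫ z in S, f z) - ∫ z in T, f z| ≤ 2 * M * volume.real A := by
  have h1 := integral_inter_add_sdiff (μ := volume) (s := S) hT (hf.mono_set hSB)
  have h2 := integral_inter_add_sdiff (μ := volume) (s := T) hS (hf.mono_set hTB)
  rw [Set.inter_comm] at h2
  have hb : ∀ U : Set (Space d), U ⊆ A → U ⊆ B → |∫ z in U, f z| ≤ M * volume.real A := by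
    intro U hUA hUB
    have := norm_setIntegral_le_of_norm_le_const (μ := volume) (s := U) (f := f) (C := M)
      (lt_of_le_of_lt (measure_mono hUA) hA.lt_top) (fun z hz => hM z (hUB hz))
    refine this.trans (mul_le_mul_of_nonneg_left (measureReal_mono hUA hA) hM0)
  have h3 := hb (S \ T) (fun z hz => hST z (hSB hz.1) (by have := hz.1; have := hz.2; tauto))
    (fun z hz => hSB hz.1)
  have h4 := hb (T \ S) (fun z hz => hST z (hTB hz.1) (by have := hz.1; have := hz.2; tauto))
    (fun z hz => hTB hz.1)
  rw [abs_le] at h3 h4 ⊢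
  constructor <;> linarith [h3.1, h3.2, h4.1, h4.2]

lemma setIntegral_preimage_linearIsometryEquiv (U : Space d ≃ₗᵢ[ℝ] Space d) (f : Space d → ℝ)
    (S : Set (Space d)) : ∫ z in U ⁻¹' S, f (U z) = ∫ z in S, f z :=
  U.measurePreserving.setIntegral_preimage_emb U.toHomeomorph.measurableEmbedding f S

/-- The part of the rescaled domain `ε⁻¹ (Ω - x)` in the ball of radius `2`. -/
def blowup (Ω : Set (Space d)) (ε : ℝ) (x : Space d) : Set (Space d) :=
  {z | z ∈ ball (0 : Space d) 2 ∧ x + ε • z ∈ Ω}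

lemma blowup_subset (Ω : Set (Space d)) (ε : ℝ) (x : Space d) : blowup Ω ε x ⊆ ball 0 2 :=
  fun _ hz => hz.1

lemma isOpen_blowup {Ω : Set (Space d)} (hΩ : IsOpen Ω) (ε : ℝ) (x : Space d) :
    IsOpen (blowup Ω ε x) :=
  isOpen_ball.inter (hΩ.preimage (by fun_prop : Continuous fun z : Space d => x + ε • z))

/-- The Jacobian `ε ^ d` cancels the normalization of the kernel, and restricting to the ball of
radius `2` loses nothing because `η` vanishes from `2` on. -/
lemma setIntegral_etaEps_mul {η : ℝ → ℝ} (hη : IsKernel η) {Ω : Set (Space d)} (hΩ : IsOpen Ω)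
    {ε : ℝ} (hε : 0 < ε) (x : Space d) (g : Space d → ℝ) :
    ∫ y in Ω, etaEps d η ε ‖x - y‖ * g y = ∫ z in blowup Ω ε x, η ‖z‖ * g (x + ε • z) := by
  rw [← integral_indicator hΩ.measurableSet,
    ← integral_indicator (isOpen_blowup hΩ ε x).measurableSet]
  set f := Ω.indicator fun y => etaEps d η ε ‖x - y‖ * g y with hf
  have h1 : ∫ y, f y = ∫ y, f (x + y) := (integral_add_left_eq_self f x).symm
  have h2 := Measure.integral_comp_smul (volume : Measure (Space d)) (fun y => f (x + y)) ε
  rw [h1]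
  have h3 : (∫ y, f (x + y)) = ∫ z, ε ^ d * f (x + ε • z) := by
    rw [integral_const_mul, h2, finrank_euclideanSpace, Fintype.card_fin,
      abs_of_pos (by positivity), smul_eq_mul, ← mul_assoc, mul_inv_cancel₀ (by positivity),
      one_mul]
  rw [h3]
  congr 1
  ext z
  have hn : ‖x - (x + ε • z)‖ = ε * ‖z‖ := by
    rw [sub_add_cancel_left, norm_neg, norm_smul, Real.norm_of_nonneg hε.le]
  by_cases h : x + ε • z ∈ Ω
  · rw [hf, Set.indicator_of_mem h, etaEps, hn, mul_div_cancel_left₀ _ hε.ne']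
    by_cases h5 : z ∈ ball (0 : Space d) 2
    · rw [Set.indicator_of_mem (show z ∈ blowup Ω ε x from ⟨h5, h⟩)]
      field_simp
    · rw [Set.indicator_of_notMem (fun h6 : z ∈ blowup Ω ε x => h5 h6.1)]
      rw [mem_ball_zero_iff, not_lt] at h5
      simp [hη.eq_zero _ h5]
  · rw [hf, Set.indicator_of_notMem h,
      Set.indicator_of_notMem (fun h6 : z ∈ blowup Ω ε x => h h6.2), mul_zero]

end NonlocalLaplacian

/-! ### Moments of the kernel over half balls -/

namespace NonlocalLaplacian

open MeasureTheory Metric Set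

variable {d : ℕ}

/-- The part of the ball of radius `2` on one side of the hyperplane `⟨v, z⟩ = t`. -/
def halfBall (v : Space d) (t : ℝ) : Set (Space d) :=
  {z | z ∈ ball (0 : Space d) 2 ∧ inner ℝ v z < t}

lemma halfBall_subset (v : Space d) (t : ℝ) : halfBall v t ⊆ ball 0 2 := fun _ hz => hz.1

lemma isOpen_halfBall (v : Space d) (t : ℝ) : IsOpen (halfBall v t) :=
  isOpen_ball.inter
    (isOpen_lt (by fun_prop : Continuous fun z : Space d => inner ℝ v z) continuous_const)

lemma halfBall_eq_ball {v : Space d} (hv : ‖v‖ = 1) {t : ℝ} (ht : 2 ≤ t) :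
    halfBall v t = ball 0 2 := by
  refine Set.Subset.antisymm (halfBall_subset v t) fun z hz => ⟨hz, ?_⟩
  rw [mem_ball_zero_iff] at hz
  have := real_inner_le_norm v z
  rw [hv, one_mul] at this
  linarith

/-- Both sums are the trace of the operator that represents `Q` through the Riesz isomorphism. -/
lemma sum_bilin_basis_eq {ι κ : Type*} [Fintype ι] [Fintype κ] (b : OrthonormalBasis ι ℝ (Space d))
    (c : OrthonormalBasis κ ℝ (Space d)) (Q : Space d →L[ℝ] Space d →L[ℝ] ℝ) :
    ∑ i, Q (b i) (b i) = ∑ i, Q (c i) (c i) := by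
  let T : Space d →ₗ[ℝ] Space d :=
    (InnerProductSpace.toDual ℝ (Space d)).symm.toLinearEquiv.toLinearMap ∘ₗ Q.toLinearMap
  have hT : ∀ u w, inner ℝ u (T w) = Q w u := by
    intro u w
    rw [real_inner_comm]
    exact InnerProductSpace.toDual_symm_apply
  have h1 := LinearMap.trace_eq_sum_inner T b
  have h2 := LinearMap.trace_eq_sum_inner T c
  simp only [hT] at h1 h2
  rw [← h1, ← h2]

/-- The half ball `B(0, 2) ∩ {z_d > -t}`. -/
def lastHalfBall (hd : 2 ≤ d) (t : ℝ) : Set (Space d) :=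
  ball (0 : Space d) 2 ∩ {z : Space d | -t < z (lastIdx hd)}

lemma firstIdx_ne_lastIdx (hd : 2 ≤ d) : firstIdx hd ≠ lastIdx hd := by
  simp only [firstIdx, lastIdx, ne_eq, Fin.mk.injEq]; omega

/-- One of the two indices is not the last one. Flipping the sign of that coordinate preserves the
half ball and negates the integrand. -/
lemma integral_lastHalfBall_mul (hd : 2 ≤ d) (η : ℝ → ℝ) (t : ℝ) {i j : Fin d} (hij : i ≠ j) :
    ∫ z in lastHalfBall hd t, η ‖z‖ * (z i * z j) = 0 := by
  wlog hi : i ≠ lastIdx hd generalizing i j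
  · simp only [ne_eq, not_not] at hi
    have := this hij.symm (by rw [← hi]; exact hij.symm)
    simpa only [mul_comm] using this
  let U : Space d ≃ₗᵢ[ℝ] Space d := LinearIsometryEquiv.piLpCongrRight 2
    (fun k => if k = i then LinearIsometryEquiv.neg ℝ else LinearIsometryEquiv.refl ℝ ℝ)
  have hU : ∀ (z : Space d) k, U z k = if k = i then - z k else z k := by
    intro z k
    simp only [U, LinearIsometryEquiv.piLpCongrRight_apply]
    split_ifs <;> rfl
  have hS : U ⁻¹' lastHalfBall hd t = lastHalfBall hd t := by
    ext z
    simp only [lastHalfBall, Set.mem_preimage, Set.mem_inter_iff, mem_ball_zero_iff,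
      LinearIsometryEquiv.norm_map]
    have : U z (lastIdx hd) = z (lastIdx hd) := by rw [hU, if_neg hi.symm]
    simp [this]
  have h := setIntegral_preimage_linearIsometryEquiv U (fun z => η ‖z‖ * (z i * z j))
    (lastHalfBall hd t)
  simp only [hS, LinearIsometryEquiv.norm_map, hU, if_true, if_neg hij.symm] at h
  have h2 : ∀ z : Space d, η ‖z‖ * (-z i * z j) = -(η ‖z‖ * (z i * z j)) := fun z => by ring
  simp only [h2, integral_neg] at h
  linarith

lemma integral_swap (η : ℝ → ℝ) (i j : Fin d) (S : Set (Space d))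
    (hS : LinearIsometryEquiv.piLpCongrLeft 2 ℝ ℝ (Equiv.swap i j) ⁻¹' S = S) :
    ∫ z in S, η ‖z‖ * z i ^ 2 = ∫ z in S, η ‖z‖ * z j ^ 2 := by
  have h := setIntegral_preimage_linearIsometryEquiv
    (LinearIsometryEquiv.piLpCongrLeft 2 ℝ ℝ (Equiv.swap i j)) (fun z => η ‖z‖ * (z j) ^ 2) S
  rw [hS] at h
  rw [← h]
  simp only [LinearIsometryEquiv.norm_map, LinearIsometryEquiv.piLpCongrLeft_apply]
  simp [Equiv.piCongrLeft'_apply]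

lemma integral_lastHalfBall_sq (hd : 2 ≤ d) (η : ℝ → ℝ) (t : ℝ) {i : Fin d}
    (hi : i ≠ lastIdx hd) :
    ∫ z in lastHalfBall hd t, η ‖z‖ * z i ^ 2 = sigma1 hd η t := by
  refine integral_swap η i (firstIdx hd) _ ?_
  ext z
  simp only [lastHalfBall, Set.mem_preimage, Set.mem_inter_iff, mem_ball_zero_iff,
      LinearIsometryEquiv.norm_map]
  have : LinearIsometryEquiv.piLpCongrLeft 2 ℝ ℝ (Equiv.swap i (firstIdx hd)) z (lastIdx hd)
      = z (lastIdx hd) := by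
    simp [LinearIsometryEquiv.piLpCongrLeft_apply, Equiv.piCongrLeft'_apply,
      Equiv.swap_apply_of_ne_of_ne hi.symm (firstIdx_ne_lastIdx hd).symm]
  simp [this]

lemma lastHalfBall_subset (hd : 2 ≤ d) (t : ℝ) : lastHalfBall hd t ⊆ ball 0 2 := fun _ hz => hz.1

lemma IsKernel.integral_lastHalfBall_last {η : ℝ → ℝ} (hη : IsKernel η) (hd : 2 ≤ d) (t : ℝ) :
    ∫ z in lastHalfBall hd t, η ‖z‖ * z (lastIdx hd) ^ 2 = sigma1 hd η t + sigma2 hd η t := by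
  have h1 := (hη.integrableOn_mul (g := fun z : Space d => z (firstIdx hd) ^ 2)
    (by fun_prop)).mono_set (lastHalfBall_subset hd t)
  have h2 := (hη.integrableOn_mul (g := fun z : Space d => z (lastIdx hd) ^ 2 -
    z (firstIdx hd) ^ 2) (by fun_prop)).mono_set (lastHalfBall_subset hd t)
  have h3 := integral_add h1 h2
  calc _ = ∫ z in lastHalfBall hd t, (η ‖z‖ * z (firstIdx hd) ^ 2 +
      η ‖z‖ * (z (lastIdx hd) ^ 2 - z (firstIdx hd) ^ 2)) := by
        congr 1; ext z; ring
    _ = _ := h3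

lemma lastHalfBall_eq_ball (hd : 2 ≤ d) {t : ℝ} (ht : 2 ≤ t) : lastHalfBall hd t = ball 0 2 := by
  refine Set.Subset.antisymm (lastHalfBall_subset hd t) fun z hz => ⟨hz, ?_⟩
  rw [mem_ball_zero_iff] at hz
  have := PiLp.norm_apply_le z (lastIdx hd)
  rw [Real.norm_eq_abs] at this
  have := neg_abs_le (z (lastIdx hd))
  change -t < z (lastIdx hd)
  linarith

/-- The half ball is then the whole ball, which is symmetric under exchange of the first and last
coordinates. -/
lemma IsKernel.sigma2_eq_zero {η : ℝ → ℝ} (hη : IsKernel η) (hd : 2 ≤ d) {t : ℝ} (ht : 2 ≤ t) :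
    sigma2 hd η t = 0 := by
  have h := hη.integral_lastHalfBall_last hd t
  have h2 : ∫ z in lastHalfBall hd t, η ‖z‖ * z (lastIdx hd) ^ 2 = sigma1 hd η t := by
    refine integral_swap η (lastIdx hd) (firstIdx hd) _ ?_
    change _ ⁻¹' lastHalfBall hd t = lastHalfBall hd t
    rw [lastHalfBall_eq_ball hd ht]
    ext z
    simp
  linarith

/-- The second moments of the kernel over a half ball with outward normal `v`. -/
lemma IsKernel.integral_halfBall_bilin {η : ℝ → ℝ} (hη : IsKernel η) (hd : 2 ≤ d) {v : Space d}
    (hv : ‖v‖ = 1) (t : ℝ) (Q : Space d →L[ℝ] Space d →L[ℝ] ℝ) :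
    ∫ z in halfBall v t, η ‖z‖ * Q z z = sigma1 hd η t *
      ∑ i, Q (EuclideanSpace.single i 1) (EuclideanSpace.single i 1) + sigma2 hd η t * Q v v := by
  set e := EuclideanSpace.basisFun (Fin d) ℝ with he
  set l := lastIdx hd with hl
  -- An isometry sending the last basis vector to `-v`, so that `z_d > -t` becomes `⟨v, U z⟩ < t`.
  let U : Space d ≃ₗᵢ[ℝ] Space d := (Submodule.span ℝ {e l - (-v)})ᗮ.reflection
  have hUl : U (e l) = -v := Submodule.reflection_sub (by simp [hv, e])
  have hUadj : ∀ z, inner ℝ v (U z) = - z l := by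
    intro z
    have : v = U (-(e l)) := by rw [map_neg, hUl, neg_neg]
    rw [this, LinearIsometryEquiv.inner_map_map, inner_neg_left]
    simp [e, EuclideanSpace.inner_single_left]
  have hS : U ⁻¹' halfBall v t = lastHalfBall hd t := by
    ext z
    simp only [lastHalfBall, halfBall, Set.mem_preimage, Set.mem_inter_iff, mem_ball_zero_iff,
      Set.mem_ofPred_eq, LinearIsometryEquiv.norm_map, hUadj]
    constructor <;> rintro ⟨h1, h2⟩ <;> exact ⟨h1, by linarith⟩
  rw [← setIntegral_preimage_linearIsometryEquiv U, hS]
  have hexp : ∀ z : Space d, η ‖U z‖ * Q (U z) (U z) =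
      ∑ i, ∑ j, Q (U (e i)) (U (e j)) * (η ‖z‖ * (z i * z j)) := by
    intro z
    have hz : z = ∑ i, z i • e i := by
      conv_lhs => rw [← e.sum_repr z]
      simp [e]
    have hz2 : U z = ∑ i, z i • U (e i) := by
      conv_lhs => rw [hz]
      simp [map_sum]
    rw [LinearIsometryEquiv.norm_map, hz2]
    simp only [map_sum, map_smul, _root_.sum_apply,
      smul_eq_mul, Finset.mul_sum, FunLike.coe_smul, Pi.smul_apply]
    rw [Finset.sum_comm]
    refine Finset.sum_congr rfl fun i _ => Finset.sum_congr rfl fun j _ => ?_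
    ring
  have hint : ∀ i j : Fin d, IntegrableOn (fun z : Space d => Q (U (e i)) (U (e j)) *
      (η ‖z‖ * (z i * z j))) (lastHalfBall hd t) := fun i j =>
    ((hη.integrableOn_mul (by fun_prop)).mono_set (lastHalfBall_subset hd t)).const_mul _
  simp only [hexp]
  rw [integral_finsetSum _ fun i _ => integrable_finsetSum _ fun j _ => hint i j]
  -- Off-diagonal moments vanish and every diagonal one is `σ₁`, except the last, which is `σ₁ +
  -- σ₂`.
  have hin : ∀ i, ∫ z in lastHalfBall hd t, ∑ j, Q (U (e i)) (U (e j)) * (η ‖z‖ * (z i * z j)) =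
      sigma1 hd η t * Q (U (e i)) (U (e i)) + if i = l then sigma2 hd η t * Q v v else 0 := by
    intro i
    rw [integral_finsetSum _ fun j _ => hint i j, Finset.sum_eq_single i]
    · rw [integral_const_mul]
      have h2 : ∀ z : Space d, z i * z i = z i ^ 2 := fun z => by ring
      simp only [h2]
      split_ifs with h
      · rw [h, hη.integral_lastHalfBall_last, hUl]
        simp
        ring
      · rw [integral_lastHalfBall_sq hd η t h]; ring
    · intro j _ hj
      rw [integral_const_mul, integral_lastHalfBall_mul hd η t hj.symm, mul_zero]
    · simp
  simp only [hin, Finset.sum_add_distrib, Finset.sum_ite_eq', Finset.mem_univ, if_true]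
  rw [← Finset.mul_sum]
  have := sum_bilin_basis_eq (e.map U) e Q
  simp only [OrthonormalBasis.map_apply] at this
  rw [this]
  simp [e]

/-- Needed to cancel the `σ_η` in the coefficient `σ₁ / σ_η` against the one in the weighted
Laplacian. -/
lemma IsKernel.sigmaEta_pos {η : ℝ → ℝ} (hη : IsKernel η) (hd : 2 ≤ d) : 0 < sigmaEta hd η := by
  have hsupp : ∀ z : Space d, z ∉ ball (0 : Space d) 2 → η ‖z‖ * z (firstIdx hd) ^ 2 = 0 := by
    intro z hz
    rw [mem_ball_zero_iff, not_lt] at hz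
    rw [hη.eq_zero _ hz, zero_mul]
  have hint := hη.integrableOn_mul (g := fun z : Space d => z (firstIdx hd) ^ 2) (by fun_prop)
  have h1 : sigmaEta hd η = ∫ z in ball (0 : Space d) 2, η ‖z‖ * z (firstIdx hd) ^ 2 :=
    (setIntegral_eq_integral_of_forall_compl_eq_zero fun z hz => hsupp z hz).symm
  rw [h1]
  have hnn : ∀ z : Space d, 0 ≤ η ‖z‖ * z (firstIdx hd) ^ 2 := fun z =>
    mul_nonneg (hη.nonneg _ (norm_nonneg z)) (sq_nonneg _)
  rw [setIntegral_pos_iff_support_of_nonneg_ae (Filter.Eventually.of_forall hnn) hint]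
  let U : Set (Space d) := ball 0 1 ∩ {z | 0 < z (firstIdx hd)}
  have hU : IsOpen U := isOpen_ball.inter (isOpen_lt continuous_const (by fun_prop))
  have hUne : U.Nonempty := by
    refine ⟨EuclideanSpace.single (firstIdx hd) (1/2), ?_, ?_⟩
    · rw [mem_ball_zero_iff]; simp; norm_num
    · simp
  refine lt_of_lt_of_le (hU.measure_pos volume hUne) (measure_mono ?_)
  rintro z ⟨hz1, hz2⟩
  have hz2 : 0 < z (firstIdx hd) := hz2
  refine ⟨?_, ball_subset_ball (by norm_num) hz1⟩
  rw [Function.mem_support]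
  rw [mem_ball_zero_iff] at hz1
  have := hη.one_le _ (norm_nonneg z) hz1.le
  positivity

lemma integral_ball_odd (η : ℝ → ℝ) (ℓ : Space d →L[ℝ] ℝ) :
    ∫ z in ball (0 : Space d) 2, η ‖z‖ * ℓ z = 0 := by
  have h := setIntegral_preimage_linearIsometryEquiv (LinearIsometryEquiv.neg ℝ)
    (fun z : Space d => η ‖z‖ * ℓ z) (ball 0 2)
  have hS : (LinearIsometryEquiv.neg ℝ : Space d ≃ₗᵢ[ℝ] Space d) ⁻¹' ball 0 2 = ball 0 2 := by
    ext z; simp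
  rw [hS] at h
  simp only [norm_neg, LinearIsometryEquiv.coe_neg, map_neg, mul_neg,
    integral_neg] at h
  linarith

end NonlocalLaplacian

/-! ### Taylor expansion along polygonal paths and bounds from the `C^k` norm -/

namespace NonlocalLaplacian

open MeasureTheory Metric Set

variable {d : ℕ}

/-- The union of the segments from `x` to `a`, from `a` to `b` and from `b` to `y`. -/
def polyPath (x a b y : Space d) : Set (Space d) := segment ℝ x a ∪ segment ℝ a b ∪ segment ℝ b y

/-- The length of `polyPath x a b y`. -/
noncomputable def polyLength (x a b y : Space d) : ℝ := ‖a - x‖ + ‖b - a‖ + ‖y - b‖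

lemma polyLength_nonneg (x a b y : Space d) : 0 ≤ polyLength x a b y := by
  unfold polyLength; positivity

lemma right_mem_polyPath (x a b y : Space d) : y ∈ polyPath x a b y :=
  Or.inr (right_mem_segment ℝ b y)

lemma left_mem_polyPath (x a b y : Space d) : x ∈ polyPath x a b y :=
  Or.inl (Or.inl (left_mem_segment ℝ x a))

variable {F : Type*} [NormedAddCommGroup F] [NormedSpace ℝ F]

lemma norm_sub_le_of_segment {f : Space d → F} {a b : Space d} {K : ℝ}
    (hf : ∀ z ∈ segment ℝ a b, DifferentiableAt ℝ f z)
    (hK : ∀ z ∈ segment ℝ a b, ‖fderiv ℝ f z‖ ≤ K) {z : Space d} (hz : z ∈ segment ℝ a b) :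
    ‖f z - f a‖ ≤ K * ‖b - a‖ := by
  have h := (convex_segment a b).norm_image_sub_le_of_norm_fderiv_le hf hK
    (left_mem_segment ℝ a b) hz
  have hK0 : 0 ≤ K := (norm_nonneg _).trans (hK z hz)
  refine h.trans (mul_le_mul_of_nonneg_left ?_ hK0)
  rw [← dist_eq_norm, ← dist_eq_norm]
  have := dist_add_dist_of_mem_segment hz
  rw [dist_comm z a, dist_comm b a]
  linarith [dist_nonneg (x := z) (y := b)]

/-- The mean value inequality along a polygonal path. -/
lemma norm_sub_le_of_polyPath {f : Space d → F} {x a b y : Space d} {K : ℝ}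
    (hf : ∀ z ∈ polyPath x a b y, DifferentiableAt ℝ f z)
    (hK : ∀ z ∈ polyPath x a b y, ‖fderiv ℝ f z‖ ≤ K) {z : Space d} (hz : z ∈ polyPath x a b y) :
    ‖f z - f x‖ ≤ K * polyLength x a b y := by
  have hK0 : 0 ≤ K := (norm_nonneg _).trans (hK z hz)
  have h1 : ∀ w ∈ segment ℝ x a, ‖f w - f x‖ ≤ K * ‖a - x‖ := fun w hw =>
    norm_sub_le_of_segment (fun z hz => hf z (Or.inl (Or.inl hz)))
      (fun z hz => hK z (Or.inl (Or.inl hz))) hw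
  have h2 : ∀ w ∈ segment ℝ a b, ‖f w - f a‖ ≤ K * ‖b - a‖ := fun w hw =>
    norm_sub_le_of_segment (fun z hz => hf z (Or.inl (Or.inr hz)))
      (fun z hz => hK z (Or.inl (Or.inr hz))) hw
  have h3 : ∀ w ∈ segment ℝ b y, ‖f w - f b‖ ≤ K * ‖y - b‖ := fun w hw =>
    norm_sub_le_of_segment (fun z hz => hf z (Or.inr hz)) (fun z hz => hK z (Or.inr hz)) hw
  have p1 : 0 ≤ K * ‖a - x‖ := by positivity
  have p2 : 0 ≤ K * ‖b - a‖ := by positivity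
  have p3 : 0 ≤ K * ‖y - b‖ := by positivity
  have e1 := h1 a (right_mem_segment ℝ x a)
  have e2 := h2 b (right_mem_segment ℝ a b)
  have t2 := fun w => norm_sub_le_norm_sub_add_norm_sub (f w) (f a) (f x)
  have t3 := fun w => norm_sub_le_norm_sub_add_norm_sub (f w) (f b) (f a)
  unfold polyLength
  rcases hz with (hz | hz) | hz
  · linarith [h1 z hz]
  · linarith [h2 z hz, t2 z]
  · linarith [h3 z hz, t3 z, t2 z]

variable {Ω : Set (Space d)}

lemma differentiableAt_fderiv {f : Space d → ℝ} (hΩ : IsOpen Ω) (hf : ContDiffOn ℝ 2 f Ω)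
    {z : Space d} (hz : z ∈ Ω) : DifferentiableAt ℝ (fderiv ℝ f) z :=
  ((hf.contDiffAt (hΩ.mem_nhds hz)).fderiv_right (m := 1) (by norm_num)).differentiableAt
    (by norm_num)

set_option maxSynthPendingDepth 3 in
lemma differentiableAt_fderiv_fderiv {f : Space d → ℝ} (hΩ : IsOpen Ω) (hf : ContDiffOn ℝ 3 f Ω)
    {z : Space d} (hz : z ∈ Ω) : DifferentiableAt ℝ (fderiv ℝ (fderiv ℝ f)) z :=
  (((hf.contDiffAt (hΩ.mem_nhds hz)).fderiv_right (m := 2) (by norm_num)).fderiv_right (m := 1)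
    (by norm_num)).differentiableAt (by norm_num)

/-- First order Taylor expansion along a polygonal path. -/
lemma abs_taylor_one_le {f : Space d → ℝ} (hΩ : IsOpen Ω) (hf : ContDiffOn ℝ 2 f Ω) {M : ℝ}
    (hM : ∀ z ∈ Ω, ‖fderiv ℝ (fderiv ℝ f) z‖ ≤ M) {x a b y : Space d}
    (hp : polyPath x a b y ⊆ Ω) :
    |f y - f x - fderiv ℝ f x (y - x)| ≤ M * polyLength x a b y ^ 2 := by
  set L := polyLength x a b y
  have h1 : ∀ z ∈ polyPath x a b y, ‖fderiv ℝ f z - fderiv ℝ f x‖ ≤ M * L := fun z hz =>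
    norm_sub_le_of_polyPath (fun w hw => differentiableAt_fderiv hΩ hf (hp hw))
      (fun w hw => hM w (hp hw)) hz
  -- Subtracting the linear part leaves a function whose derivative is at most `M L` on the path;
  -- the mean value inequality then gives `M L²`. The sharp factor `1/2` is not sought.
  have hd : ∀ z ∈ polyPath x a b y, HasFDerivAt (fun z => f z - fderiv ℝ f x (z - x))
      (fderiv ℝ f z - fderiv ℝ f x) z := by
    intro z hz
    have e1 := ((hf.differentiableOn (by norm_num)).differentiableAt
      (hΩ.mem_nhds (hp hz))).hasFDerivAt
    have e2 := (fderiv ℝ f x).hasFDerivAt.comp z ((hasFDerivAt_id z).sub_const x)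
    exact e1.sub e2
  have h2 := norm_sub_le_of_polyPath (fun z hz => (hd z hz).differentiableAt)
    (fun z hz => by rw [(hd z hz).fderiv]; exact h1 z hz) (right_mem_polyPath x a b y)
  simp only [sub_self, map_zero, sub_zero, Real.norm_eq_abs] at h2
  calc _ = |f y - fderiv ℝ f x (y - x) - f x| := by congr 1; ring
    _ ≤ _ := h2
    _ = _ := by ring

set_option maxSynthPendingDepth 3 in
/-- Second order Taylor expansion along a polygonal path. -/
lemma abs_taylor_two_le {f : Space d → ℝ} (hΩ : IsOpen Ω) (hf : ContDiffOn ℝ 3 f Ω) {M : ℝ}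
    (hM : ∀ z ∈ Ω, ‖fderiv ℝ (fderiv ℝ (fderiv ℝ f)) z‖ ≤ M) {x a b y : Space d}
    (hp : polyPath x a b y ⊆ Ω) :
    |f y - f x - fderiv ℝ f x (y - x) - 1 / 2 * fderiv ℝ (fderiv ℝ f) x (y - x) (y - x)|
      ≤ M * polyLength x a b y ^ 3 := by
  set L := polyLength x a b y
  have hxΩ := hp (left_mem_polyPath x a b y)
  set B := fderiv ℝ (fderiv ℝ f) x with hB
  -- Symmetry of the Hessian makes `B (z - x)` the derivative of `½ B (z - x) (z - x)`.
  have hsymm : ∀ u w, B u w = B w u := fun u w =>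
    ((hf.contDiffAt (hΩ.mem_nhds hxΩ)).isSymmSndFDerivAt (by simp; norm_num)) u w
  have h1 : ∀ z ∈ polyPath x a b y, ‖fderiv ℝ (fderiv ℝ f) z - B‖ ≤ M * L := fun z hz =>
    norm_sub_le_of_polyPath (fun w hw => differentiableAt_fderiv_fderiv hΩ hf (hp hw))
      (fun w hw => hM w (hp hw)) hz
  have hd1 : ∀ z ∈ polyPath x a b y, HasFDerivAt (fun z => fderiv ℝ f z - B (z - x))
      (fderiv ℝ (fderiv ℝ f) z - B) z := by
    intro z hz
    have e1 := (differentiableAt_fderiv hΩ (hf.of_le (by norm_num)) (hp hz)).hasFDerivAt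
    have e2 := B.hasFDerivAt.comp z ((hasFDerivAt_id z).sub_const x)
    exact e1.sub e2
  have h2 : ∀ z ∈ polyPath x a b y, ‖fderiv ℝ f z - fderiv ℝ f x - B (z - x)‖ ≤ M * L * L := by
    intro z hz
    have := norm_sub_le_of_polyPath (fun z hz => (hd1 z hz).differentiableAt)
      (fun z hz => by rw [(hd1 z hz).fderiv]; exact h1 z hz) hz
    simp only [sub_self, map_zero, sub_zero] at this
    rwa [sub_right_comm] at this
  have hd2 : ∀ z ∈ polyPath x a b y,
      HasFDerivAt (fun z => f z - fderiv ℝ f x (z - x) - 1 / 2 * B (z - x) (z - x))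
      (fderiv ℝ f z - fderiv ℝ f x - B (z - x)) z := by
    intro z hz
    have e1 := ((hf.differentiableOn (by norm_num)).differentiableAt
      (hΩ.mem_nhds (hp hz))).hasFDerivAt
    have e0 := (hasFDerivAt_id (𝕜 := ℝ) z).sub_const x
    have e2 := (fderiv ℝ f x).hasFDerivAt.comp z e0
    have e3 := (B.hasFDerivAt.comp z e0).clm_apply e0
    refine ((e1.sub e2).sub (e3.const_mul (1 / 2 : ℝ))).congr_fderiv ?_
    ext w
    simp [hsymm w z, hsymm w x]
    ring
  have h3 := norm_sub_le_of_polyPath (fun z hz => (hd2 z hz).differentiableAt)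
    (fun z hz => by rw [(hd2 z hz).fderiv]; exact h2 z hz) (right_mem_polyPath x a b y)
  simp only [sub_self, map_zero, sub_zero, mul_zero, Real.norm_eq_abs] at h3
  calc _ = |f y - fderiv ℝ f x (y - x) - 1 / 2 * B (y - x) (y - x) - f x| := by congr 1; ring
    _ ≤ _ := h3
    _ = _ := by ring

lemma polyPath_self_self (x y : Space d) : polyPath x x x y = segment ℝ x y := by
  simp [polyPath, left_mem_segment]

lemma polyLength_self_self (x y : Space d) : polyLength x x x y = ‖y - x‖ := by
  simp [polyLength]

/-- Without boundedness the real supremum in `ckNorm` would take the default value `0` and bound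
nothing. -/
lemma IsCkClosure.bddAbove {k : ℕ} {f : Space d → ℝ} (hb : Bornology.IsBounded Ω)
    (hf : IsCkClosure k Ω f) {m : ℕ} (hm : m ≤ k) :
    BddAbove (Set.range fun x : Ω => ‖iteratedFDeriv ℝ m f (x : Space d)‖) := by
  obtain ⟨g, hg, hfg⟩ := hf.2 m hm
  obtain ⟨C, hC⟩ := hb.isCompact_closure.exists_bound_of_continuousOn hg
  refine ⟨C, ?_⟩
  rintro _ ⟨x, rfl⟩
  have := hC x (subset_closure x.2)
  rwa [← hfg x.2] at this

lemma ckNorm_nonneg (k : ℕ) (Ω : Set (Space d)) (f : Space d → ℝ) : 0 ≤ ckNorm k Ω f :=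
  Finset.sum_nonneg fun _ _ => Real.iSup_nonneg fun _ => norm_nonneg _

lemma IsCkClosure.norm_iteratedFDeriv_le {k : ℕ} {f : Space d → ℝ} (hb : Bornology.IsBounded Ω)
    (hf : IsCkClosure k Ω f) {m : ℕ} (hm : m ≤ k) {x : Space d} (hx : x ∈ Ω) :
    ‖iteratedFDeriv ℝ m f x‖ ≤ ckNorm k Ω f := by
  have h1 := le_ciSup (hf.bddAbove hb hm) ⟨x, hx⟩
  refine h1.trans ?_
  exact Finset.single_le_sum
    (f := fun m => ⨆ x : Ω, ‖iteratedFDeriv ℝ m f (x : Space d)‖)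
    (fun _ _ => Real.iSup_nonneg fun _ => norm_nonneg _) (Finset.mem_range.2 (by omega))

lemma IsCkClosure.abs_le {k : ℕ} {f : Space d → ℝ} (hb : Bornology.IsBounded Ω)
    (hf : IsCkClosure k Ω f) {x : Space d} (hx : x ∈ Ω) : |f x| ≤ ckNorm k Ω f := by
  have := hf.norm_iteratedFDeriv_le hb (Nat.zero_le k) hx
  rwa [norm_iteratedFDeriv_zero] at this

lemma IsCkClosure.norm_fderiv_le {k : ℕ} {f : Space d → ℝ} (hb : Bornology.IsBounded Ω)
    (hf : IsCkClosure k Ω f) (hk : 1 ≤ k) {x : Space d} (hx : x ∈ Ω) :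
    ‖fderiv ℝ f x‖ ≤ ckNorm k Ω f := by
  have := hf.norm_iteratedFDeriv_le hb hk hx
  rwa [norm_iteratedFDeriv_one] at this

lemma IsCkClosure.norm_fderiv_two_le {k : ℕ} {f : Space d → ℝ} (hb : Bornology.IsBounded Ω)
    (hf : IsCkClosure k Ω f) (hk : 2 ≤ k) {x : Space d} (hx : x ∈ Ω) :
    ‖fderiv ℝ (fderiv ℝ f) x‖ ≤ ckNorm k Ω f := by
  have := hf.norm_iteratedFDeriv_le hb hk hx
  rwa [← norm_iteratedFDeriv_fderiv, norm_iteratedFDeriv_one] at this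

set_option maxSynthPendingDepth 3 in
lemma IsCkClosure.norm_fderiv_three_le {k : ℕ} {f : Space d → ℝ} (hb : Bornology.IsBounded Ω)
    (hf : IsCkClosure k Ω f) (hk : 3 ≤ k) {x : Space d} (hx : x ∈ Ω) :
    ‖fderiv ℝ (fderiv ℝ (fderiv ℝ f)) x‖ ≤ ckNorm k Ω f := by
  have := hf.norm_iteratedFDeriv_le hb hk hx
  rwa [← norm_iteratedFDeriv_fderiv, ← norm_iteratedFDeriv_fderiv, norm_iteratedFDeriv_one]
    at this

end NonlocalLaplacian

/-! ### Defining functions, the outward normal and nearest boundary points -/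

namespace NonlocalLaplacian

open MeasureTheory Metric Set Filter Topology

variable {d : ℕ} {Ω : Set (Space d)}

lemma graphFun_add_smul {ν : Space d} (hν : ‖ν‖ = 1) (F : Space d → ℝ) (y : Space d) (u : ℝ) :
    graphFun ν F (y + u • ν) = graphFun ν F y - u := by
  have h1 : inner ℝ ν (y + u • ν) = inner ℝ ν y + u := by
    rw [inner_add_right, inner_smul_right, real_inner_self_eq_norm_sq, hν]; ring
  unfold graphFun
  rw [h1]
  have h2 : y + u • ν - (inner ℝ ν y + u) • ν = y - inner ℝ ν y • ν := by module
  rw [h2]; ring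

lemma contDiff_graphFun {k : ℕ} {F : Space d → ℝ} (hF : ContDiff ℝ k F) (ν : Space d) :
    ContDiff ℝ k (graphFun ν F) := by
  have h1 : ContDiff ℝ k fun y : Space d => (inner ℝ ν y : ℝ) := contDiff_const.inner ℝ contDiff_id
  exact (hF.comp (contDiff_id.sub (h1.smul contDiff_const))).sub h1

lemma notMem_of_mem_frontier (hΩ : IsOpen Ω) {p : Space d} (hp : p ∈ frontier Ω) : p ∉ Ω := by
  rw [hΩ.frontier_eq] at hp
  exact hp.2

namespace IsLocalGraph

variable {k : ℕ} {p ν : Space d} {F : Space d → ℝ} {r : ℝ}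

/-- A negative value would put `q` in the open set `Ω`, a positive one outside its closure. -/
lemma graphFun_eq_zero (h : IsLocalGraph k Ω p ν F r) (hΩ : IsOpen Ω) {q : Space d}
    (hq : q ∈ ball p r) (hqf : q ∈ frontier Ω) : graphFun ν F q = 0 := by
  have hc : Continuous (graphFun ν F) := (contDiff_graphFun h.contDiff ν).continuous
  rcases lt_trichotomy (graphFun ν F q) 0 with h1 | h1 | h1
  · exact absurd ((h.mem_iff q hq).2 h1) (notMem_of_mem_frontier hΩ hqf)
  · exact h1
  · have h2 : ∀ᶠ y in 𝓝 q, 0 < graphFun ν F y := hc.continuousAt.eventually (lt_mem_nhds h1)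
    have h3 := h2.and (isOpen_ball.mem_nhds hq)
    obtain ⟨y, ⟨hy1, hy2⟩, hy3⟩ :=
      (mem_closure_iff_nhds.1 (frontier_subset_closure hqf)) _ h3
    have := (h.mem_iff y hy2).1 hy3
    linarith

lemma differentiable_graphFun (h : IsLocalGraph k Ω p ν F r) (hk : 1 ≤ k) :
    Differentiable ℝ (graphFun ν F) :=
  (contDiff_graphFun h.contDiff ν).differentiable (by exact_mod_cast (by omega : k ≠ 0))

lemma fderiv_graphFun_self (h : IsLocalGraph k Ω p ν F r) (hk : 1 ≤ k) (q : Space d) :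
    fderiv ℝ (graphFun ν F) q ν = -1 := by
  have h1 := ((h.differentiable_graphFun hk) q).hasFDerivAt.hasLineDerivAt ν
  have h2 : HasLineDerivAt ℝ (graphFun ν F) (-1) q ν := by
    unfold HasLineDerivAt
    simp only [graphFun_add_smul h.norm_eq_one]
    simpa using (hasDerivAt_id (0 : ℝ)).const_sub (graphFun ν F q)
  exact h1.unique h2

lemma one_le_norm_gradient (h : IsLocalGraph k Ω p ν F r) (hk : 1 ≤ k) (q : Space d) :
    1 ≤ ‖gradient (graphFun ν F) q‖ := by
  have h1 : ‖gradient (graphFun ν F) q‖ = ‖fderiv ℝ (graphFun ν F) q‖ := by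
    simp [gradient]
  have h2 := (fderiv ℝ (graphFun ν F) q).le_opNorm ν
  rw [h.fderiv_graphFun_self hk, h.norm_eq_one] at h2
  simp at h2
  rwa [h1]

lemma restrict (h : IsLocalGraph k Ω p ν F r) {m : ℕ} (hm : m ≤ k) {q : Space d} {s : ℝ}
    (hs : 0 < s) (hsub : ball q s ⊆ ball p r) : IsLocalGraph m Ω q ν F s where
  norm_eq_one := h.norm_eq_one
  radius_pos := hs
  contDiff := h.contDiff.of_le (by exact_mod_cast hm)
  mem_iff y hy := h.mem_iff y (hsub hy)

end IsLocalGraph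

lemma inner_gradient_eq_fderiv (f : Space d → ℝ) (x w : Space d) :
    inner ℝ (gradient f x) w = fderiv ℝ f x w := by
  rw [gradient]
  exact InnerProductSpace.toDual_symm_apply

lemma eventually_neg_of_hasDerivAt {g : ℝ → ℝ} {c : ℝ} (hg : HasDerivAt g c 0) (h0 : g 0 = 0)
    (hc : c < 0) : ∀ᶠ t in 𝓝[>] (0 : ℝ), g t < 0 := by
  have h1 := hasDerivAt_iff_tendsto_slope.1 hg
  have h2 : ∀ᶠ t in 𝓝[>] (0 : ℝ), slope g 0 t < 0 :=
    (h1.mono_left (nhdsWithin_mono _ fun t (ht : 0 < t) => ht.ne')).eventually (gt_mem_nhds hc)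
  filter_upwards [h2, self_mem_nhdsWithin] with t ht ht0
  have ht0 : 0 < t := ht0
  rw [slope_def_field, h0, sub_zero, sub_zero] at ht
  by_contra hcon
  exact absurd ht (not_lt.2 (div_nonneg (not_lt.1 hcon) ht0.le))

namespace IsOutwardUnitNormal

variable {p v : Space d}

lemma norm_eq_one (h : IsOutwardUnitNormal Ω p v) : ‖v‖ = 1 := by
  obtain ⟨ν, F, r, hg, rfl⟩ := h
  have := hg.one_le_norm_gradient le_rfl p
  rw [norm_smul, norm_inv, norm_norm, inv_mul_cancel₀]
  linarith

/-- Restricting a defining function to a ray reduces entering or leaving `Ω` to the sign of a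
one-variable derivative, a positive multiple of `⟨v, w⟩`. -/
lemma exists_graph (h : IsOutwardUnitNormal Ω p v) (hΩ : IsOpen Ω) (hp : p ∈ frontier Ω)
    (w : Space d) : ∃ (g : ℝ → ℝ) (a : ℝ), 0 < a ∧ HasDerivAt g (a * inner ℝ v w) 0 ∧ g 0 = 0 ∧
      ∀ᶠ t in 𝓝[>] (0 : ℝ), (p + t • w ∈ Ω ↔ g t < 0) := by
  obtain ⟨ν, F, r, hg, rfl⟩ := h
  have ha := hg.one_le_norm_gradient le_rfl p
  refine ⟨fun t => graphFun ν F (p + t • w), ‖gradient (graphFun ν F) p‖, by linarith, ?_, ?_, ?_⟩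
  · have h1 := ((hg.differentiable_graphFun le_rfl) p).hasFDerivAt.hasLineDerivAt w
    rw [inner_smul_left, inner_gradient_eq_fderiv]
    simp only [map_inv₀, conj_trivial]
    rw [mul_inv_cancel_left₀ (by linarith)]
    exact h1
  · simpa using hg.graphFun_eq_zero hΩ (mem_ball_self hg.radius_pos) hp
  · have hc : Continuous fun t : ℝ => p + t • w := by fun_prop
    have h2 : ∀ᶠ t in 𝓝 (0 : ℝ), p + t • w ∈ ball p r :=
      hc.continuousAt.eventually (isOpen_ball.mem_nhds (by simpa using hg.radius_pos))
    filter_upwards [nhdsWithin_le_nhds h2] with t ht using hg.mem_iff _ ht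

lemma eventually_mem (h : IsOutwardUnitNormal Ω p v) (hΩ : IsOpen Ω) (hp : p ∈ frontier Ω)
    {w : Space d} (hw : inner ℝ v w < 0) : ∀ᶠ t in 𝓝[>] (0 : ℝ), p + t • w ∈ Ω := by
  obtain ⟨g, a, ha, hg, h0, hm⟩ := h.exists_graph hΩ hp w
  filter_upwards [hm, eventually_neg_of_hasDerivAt hg h0 (mul_neg_of_pos_of_neg ha hw)]
    with t h1 h2 using h1.2 h2

lemma eventually_notMem (h : IsOutwardUnitNormal Ω p v) (hΩ : IsOpen Ω) (hp : p ∈ frontier Ω)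
    {w : Space d} (hw : 0 < inner ℝ v w) : ∀ᶠ t in 𝓝[>] (0 : ℝ), p + t • w ∉ Ω := by
  obtain ⟨g, a, ha, hg, h0, hm⟩ := h.exists_graph hΩ hp w
  filter_upwards [hm, eventually_neg_of_hasDerivAt hg.neg (by simpa using h0)
    (by have := mul_pos ha hw; linarith)] with t h1 h2 h3
  have := h1.1 h3
  simp only [Pi.neg_apply] at h2
  linarith

/-- A unit vector all of whose half space points into `Ω` is the inward normal. -/
lemma eq_of_eventually_mem (h : IsOutwardUnitNormal Ω p v) (hΩ : IsOpen Ω) (hp : p ∈ frontier Ω)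
    {u : Space d} (hu : ‖u‖ = 1)
    (hin : ∀ w, inner ℝ u w < 0 → ∀ᶠ t in 𝓝[>] (0 : ℝ), p + t • w ∈ Ω) : u = v := by
  by_contra hne
  have hv := h.norm_eq_one
  -- For distinct unit vectors, `v - u` points inward according to `u` and outward according to `v`.
  have hlt : inner ℝ u v < 1 := (inner_lt_one_iff_real_of_norm_eq_one hu hv).2 hne
  have h1 : inner ℝ u (v - u) < 0 := by
    rw [inner_sub_right, real_inner_self_eq_norm_sq, hu]; linarith
  have h2 : 0 < inner ℝ v (v - u) := by
    rw [inner_sub_right, real_inner_self_eq_norm_sq, hv, real_inner_comm]; linarith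
  obtain ⟨t, h3, h4⟩ := ((hin _ h1).and (h.eventually_notMem hΩ hp h2)).exists
  exact h4 h3

/-- The normal does not depend on the chart, so the chart used for quantitative estimates may differ
from the one defining `v`. -/
lemma unique (h : IsOutwardUnitNormal Ω p v) (hΩ : IsOpen Ω) (hp : p ∈ frontier Ω)
    {u : Space d} (hu : IsOutwardUnitNormal Ω p u) : u = v :=
  h.eq_of_eventually_mem hΩ hp hu.norm_eq_one fun _ hw => hu.eventually_mem hΩ hp hw

end IsOutwardUnitNormal

namespace IsAdmissibleDomain

lemma isCompact_frontier (hΩ : IsAdmissibleDomain Ω) : IsCompact (frontier Ω) :=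
  hΩ.isBounded.isCompact_closure.of_isClosed_subset isClosed_frontier frontier_subset_closure

/-- An empty frontier would make `Ω` clopen, hence empty or the whole unbounded space. -/
lemma frontier_nonempty (hΩ : IsAdmissibleDomain Ω) (hd : 2 ≤ d) : (frontier Ω).Nonempty := by
  rw [nonempty_iff_ne_empty]
  intro h
  have : IsClopen Ω := isClopen_iff_frontier_eq_empty.2 h
  rcases isClopen_iff.1 this with h1 | h1
  · exact hΩ.isConnected.nonempty.ne_empty h1
  · have : Nonempty (Fin d) := ⟨firstIdx hd⟩
    exact NormedSpace.unbounded_univ ℝ (Space d) (h1 ▸ hΩ.isBounded)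

lemma exists_nearest (hΩ : IsAdmissibleDomain Ω) (hd : 2 ≤ d) (x : Space d) :
    ∃ p ∈ frontier Ω, dist x p = bdryDist Ω x := by
  obtain ⟨p, hp, h⟩ := hΩ.isCompact_frontier.exists_infDist_eq_dist (hΩ.frontier_nonempty hd) x
  exact ⟨p, hp, h.symm⟩

lemma bdryDist_pos (hΩ : IsAdmissibleDomain Ω) (hd : 2 ≤ d) {x : Space d} (hx : x ∈ Ω) :
    0 < bdryDist Ω x := by
  refine (isClosed_frontier.notMem_iff_infDist_pos (hΩ.frontier_nonempty hd)).1 fun h => ?_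
  exact notMem_of_mem_frontier hΩ.isOpen h hx

end IsAdmissibleDomain

/-- The ball is connected and misses the frontier, so it cannot meet both `Ω` and the exterior. -/
lemma ball_bdryDist_subset (hΩ : IsOpen Ω) {x : Space d} (hx : x ∈ Ω) (hd : 0 < bdryDist Ω x) :
    ball x (bdryDist Ω x) ⊆ Ω := by
  refine (convex_ball x (bdryDist Ω x)).isPreconnected.subset_left_of_subset_union hΩ
    isClosed_closure.isOpen_compl
    (disjoint_compl_right_iff_subset.2 subset_closure) (fun y hy => ?_)
    ⟨x, mem_ball_self hd, hx⟩
  by_contra hc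
  have hy2 : y ∈ frontier Ω := by
    rw [hΩ.frontier_eq]
    exact ⟨by_contra fun h => hc (Or.inr h), fun h => hc (Or.inl h)⟩
  have h1 : bdryDist Ω x ≤ dist x y := infDist_le_dist_of_mem hy2
  rw [mem_ball, dist_comm] at hy
  linarith

/-- The foot of the perpendicular: the outward normal at a nearest boundary point. -/
lemma sub_eq_smul_normal (hΩ : IsOpen Ω) {x p v : Space d} (hx : x ∈ Ω) (hp : p ∈ frontier Ω)
    (hxp : dist x p = bdryDist Ω x) (hd : 0 < bdryDist Ω x) (hv : IsOutwardUnitNormal Ω p v) :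
    x = p - bdryDist Ω x • v := by
  set δ := bdryDist Ω x with hδ
  have hn : ‖p - x‖ = δ := by rw [← dist_eq_norm, dist_comm, hxp]
  have hu : ‖δ⁻¹ • (p - x)‖ = 1 := by
    rw [norm_smul, hn, norm_inv, Real.norm_of_nonneg hd.le, inv_mul_cancel₀ hd.ne']
  -- The ball of radius `δ` about `x` lies in `Ω` and touches the boundary at `p`. If `⟨p - x, w⟩ <
  -- 0`, then `|p - x + t w| < δ` for small `t > 0`, so the normal of this ball must be `v`.
  have h := hv.eq_of_eventually_mem hΩ hp hu fun w hw => by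
    have hw' : inner ℝ (p - x) w < 0 := by
      rw [inner_smul_left] at hw
      simp only [map_inv₀, conj_trivial] at hw
      by_contra hc
      exact absurd hw (not_lt.2 (mul_nonneg (inv_nonneg.2 hd.le) (not_lt.1 hc)))
    have hg : HasDerivAt (fun t : ℝ => 2 * t * inner ℝ (p - x) w + t ^ 2 * ‖w‖ ^ 2)
        (2 * inner ℝ (p - x) w) 0 := by
      have := (((hasDerivAt_id (0 : ℝ)).const_mul 2).mul_const (inner ℝ (p - x) w)).add
        (((hasDerivAt_id (0 : ℝ)).pow 2).mul_const (‖w‖ ^ 2))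
      exact (this.congr_deriv (by simp))
    filter_upwards [eventually_neg_of_hasDerivAt hg (by simp) (by linarith)] with t ht
    refine ball_bdryDist_subset hΩ hx hd ?_
    rw [mem_ball, dist_eq_norm, add_sub_right_comm, ← hδ]
    refine lt_of_pow_lt_pow_left₀ 2 hd.le ?_
    rw [norm_add_sq_real, hn, inner_smul_right, norm_smul, mul_pow, Real.norm_eq_abs, sq_abs]
    linarith
  rw [← h, smul_smul, mul_inv_cancel₀ hd.ne', one_smul]
  abel

end NonlocalLaplacian

/-! ### Uniform geometry of the rescaled domain near the boundary -/

namespace NonlocalLaplacian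

open MeasureTheory Metric Set Filter Topology

variable {d : ℕ} {Ω : Set (Space d)}

/-- Quantitative description of `Ω` near the boundary point `p` with outward normal `v`: in the
ball `B(p, r)` the set `Ω` is the negativity set of a defining function `G` of graph type, which is
`K`-Lipschitz and has a second order Taylor expansion at `p` with constant `K`. -/
def HasGraphNear (Ω : Set (Space d)) (p v : Space d) (K r : ℝ) : Prop :=
  ∃ (ν : Space d) (G : Space d → ℝ), ‖ν‖ = 1 ∧ Continuous G ∧
    (∀ y (u : ℝ), G (y + u • ν) = G y - u) ∧ (∀ y ∈ ball p r, y ∈ Ω ↔ G y < 0) ∧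
    (∀ y ∈ ball p r, ∀ z ∈ ball p r, |G y - G z| ≤ K * ‖y - z‖) ∧
    ∃ (a : ℝ) (B : Space d →L[ℝ] Space d →L[ℝ] ℝ), 1 ≤ a ∧ ‖B‖ ≤ K ∧
      ∀ h, ‖h‖ < r → |G (p + h) - a * inner ℝ v h - B h h| ≤ K * ‖h‖ ^ 3

lemma HasGraphNear.mono {p v : Space d} {K K' r r' : ℝ} (h : HasGraphNear Ω p v K r)
    (hK : K ≤ K') (hr : r' ≤ r) : HasGraphNear Ω p v K' r' := by
  obtain ⟨ν, G, h1, h2, h3, h4, h5, a, B, h6, h7, h8⟩ := h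
  have hsub := ball_subset_ball (x := p) hr
  refine ⟨ν, G, h1, h2, h3, fun y hy => h4 y (hsub hy), fun y hy z hz => ?_, a, B, h6,
    h7.trans hK, fun h hh => ?_⟩
  · exact (h5 y (hsub hy) z (hsub hz)).trans (mul_le_mul_of_nonneg_right hK (norm_nonneg _))
  · exact (h8 h (hh.trans_le hr)).trans (mul_le_mul_of_nonneg_right hK (by positivity))

-- The constant bounds three derivatives of the defining function on a compact ball. Halving the
-- radius keeps the balls about nearby boundary points inside the chart.
set_option maxSynthPendingDepth 3 in
lemma IsLocalGraph.exists_hasGraphNear {p₀ ν : Space d} {F : Space d → ℝ} {r : ℝ}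
    (h : IsLocalGraph 3 Ω p₀ ν F r) (hΩ : IsOpen Ω) : ∃ K : ℝ, ∀ p ∈ frontier Ω,
      p ∈ ball p₀ (r / 2) → ∀ v, IsOutwardUnitNormal Ω p v → HasGraphNear Ω p v K (r / 2) := by
  set G := graphFun ν F with hG
  have hGc : ContDiff ℝ 3 G := contDiff_graphFun h.contDiff ν
  have hG1 : ContDiff ℝ 2 (fderiv ℝ G) := hGc.fderiv_right (m := 2) (by norm_num)
  have hG2 : ContDiff ℝ 1 (fderiv ℝ (fderiv ℝ G)) := hG1.fderiv_right (m := 1) (by norm_num)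
  have hG3 : Continuous (fderiv ℝ (fderiv ℝ (fderiv ℝ G))) := hG2.continuous_fderiv (by norm_num)
  have hcomp := isCompact_closedBall p₀ r
  obtain ⟨M1, hM1⟩ := hcomp.exists_bound_of_continuousOn hG1.continuous.continuousOn
  obtain ⟨M2, hM2⟩ := hcomp.exists_bound_of_continuousOn hG2.continuous.continuousOn
  obtain ⟨M3, hM3⟩ := hcomp.exists_bound_of_continuousOn hG3.continuousOn
  have hr := h.radius_pos
  refine ⟨max M1 (max M2 M3), fun p hpf hp v hv => ?_⟩
  have hsub : ball p (r / 2) ⊆ ball p₀ r := ball_subset_ball' (by rw [mem_ball] at hp; linarith)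
  have hpr : p ∈ ball p₀ r := hsub (mem_ball_self (by linarith))
  have ha : 1 ≤ ‖gradient G p‖ := h.one_le_norm_gradient (by norm_num) p
  have hnormal : v = ‖gradient G p‖⁻¹ • gradient G p :=
    IsOutwardUnitNormal.unique ⟨ν, F, r / 2, h.restrict (by norm_num) (by linarith) hsub, rfl⟩
      hΩ hpf hv
  refine ⟨ν, G, h.norm_eq_one, hGc.continuous, graphFun_add_smul h.norm_eq_one F,
    fun y hy => h.mem_iff y (hsub hy), fun y hy z hz => ?_, ‖gradient G p‖,
    (1 / 2 : ℝ) • fderiv ℝ (fderiv ℝ G) p, ha, ?_, fun w hw => ?_⟩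
  · rw [← Real.norm_eq_abs]
    refine (convex_ball p₀ r).norm_image_sub_le_of_norm_fderiv_le (𝕜 := ℝ)
      (fun q _ => (hGc.differentiable (by norm_num)) q) (fun q hq => ?_) (hsub hz) (hsub hy)
    exact (hM1 q (ball_subset_closedBall hq)).trans (le_max_left _ _)
  · have := hM2 p (ball_subset_closedBall hpr)
    have h2 : M2 ≤ max M1 (max M2 M3) := (le_max_left _ _).trans (le_max_right _ _)
    rw [norm_smul, Real.norm_of_nonneg (by norm_num : (0 : ℝ) ≤ 1 / 2)]
    linarith [norm_nonneg (fderiv ℝ (fderiv ℝ G) p)]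
  · have hy : p + w ∈ ball p₀ r := hsub (by rw [mem_ball, dist_self_add_left]; exact hw)
    have hT := abs_taylor_two_le isOpen_ball hGc.contDiffOn
      (fun z hz => (hM3 z (ball_subset_closedBall hz)).trans
        ((le_max_right M2 M3).trans (le_max_right M1 _)))
      (x := p) (a := p) (b := p) (y := p + w)
      (by rw [polyPath_self_self]; exact (convex_ball p₀ r).segment_subset hpr hy)
    have hGp : G p = 0 := h.graphFun_eq_zero hΩ hpr hpf
    rw [polyLength_self_self, add_sub_cancel_left, hGp] at hT
    have hin : ‖gradient G p‖ * inner ℝ v w = fderiv ℝ G p w := by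
      rw [hnormal, inner_smul_left, inner_gradient_eq_fderiv]
      simp only [map_inv₀, conj_trivial]
      rw [mul_inv_cancel_left₀ (by linarith)]
    rw [hin]
    simpa using hT

lemma IsAdmissibleDomain.exists_hasGraphNear (hΩ : IsAdmissibleDomain Ω) :
    ∃ K r : ℝ, 0 < r ∧ ∀ p ∈ frontier Ω, ∀ v, IsOutwardUnitNormal Ω p v →
      HasGraphNear Ω p v K r := by
  have key : ∃ K r : ℝ, 0 < r ∧ ∀ p ∈ frontier Ω, p ∈ frontier Ω →
      ∀ v, IsOutwardUnitNormal Ω p v → HasGraphNear Ω p v K r := by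
    refine hΩ.isCompact_frontier.induction_on (p := fun s => ∃ K r : ℝ, 0 < r ∧ ∀ p ∈ s,
      p ∈ frontier Ω → ∀ v, IsOutwardUnitNormal Ω p v → HasGraphNear Ω p v K r) ?_ ?_ ?_ ?_
    · exact ⟨0, 1, one_pos, fun p hp => absurd hp (Set.notMem_empty p)⟩
    · rintro s t hst ⟨K, r, hr, h⟩
      exact ⟨K, r, hr, fun p hp => h p (hst hp)⟩
    · rintro s t ⟨K, r, hr, h⟩ ⟨K', r', hr', h'⟩
      refine ⟨max K K', min r r', lt_min hr hr', ?_⟩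
      rintro p (hp | hp) hpf v hv
      · exact (h p hp hpf v hv).mono (le_max_left _ _) (min_le_left _ _)
      · exact (h' p hp hpf v hv).mono (le_max_right _ _) (min_le_right _ _)
    · intro p₀ hp₀
      obtain ⟨ν, F, r, hg⟩ := hΩ.boundary p₀ hp₀
      obtain ⟨K, hK⟩ := hg.exists_hasGraphNear hΩ.isOpen
      have hr : 0 < r / 2 := half_pos hg.radius_pos
      exact ⟨ball p₀ (r / 2), mem_nhdsWithin_of_mem_nhds (ball_mem_nhds p₀ hr), K, r / 2, hr,
        fun p hp hpf v hv => hK p hpf hp v hv⟩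
  obtain ⟨K, r, hr, h⟩ := key
  exact ⟨K, r, hr, fun p hp => h p hp hp⟩

/-- Near the boundary `Ω` is quasiconvex. -/
lemma HasGraphNear.exists_polyPath {p v : Space d} {K r : ℝ} (h : HasGraphNear Ω p v K r)
    (hK : 0 ≤ K) {s : ℝ} (hs : (1 + 2 * K) * s ≤ r) {x y : Space d} (hx : x ∈ Ω) (hy : y ∈ Ω)
    (hxp : x ∈ ball p s) (hyp : y ∈ ball p s) :
    ∃ a b, polyPath x a b y ⊆ Ω ∧ polyLength x a b y ≤ (1 + 2 * K) * ‖y - x‖ := by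
  obtain ⟨ν, G, hν, -, hGν, hmem, hLip, -⟩ := h
  have hs0 : 0 < s := dist_nonneg.trans_lt hxp
  have hsr : s ≤ r := by nlinarith
  -- Moving by `u` along `ν` lowers `G` by `u`, which offsets the most that `G` can rise between `x`
  -- and `y`; the lifted segment therefore stays in `Ω`.
  set u := K * ‖y - x‖ with hu
  have hyx : ‖y - x‖ < 2 * s := by
    rw [mem_ball, dist_eq_norm] at hxp hyp
    calc ‖y - x‖ = ‖(y - p) - (x - p)‖ := by congr 1; abel
      _ ≤ ‖y - p‖ + ‖x - p‖ := norm_sub_le _ _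
      _ < _ := by linarith
  have hu0 : 0 ≤ u := by positivity
  have hball : ∀ w ∈ ball p s, ∀ c, 0 ≤ c → c ≤ u → w + c • ν ∈ ball p r := by
    intro w hw c hc0 hcu
    rw [mem_ball, dist_eq_norm] at hw ⊢
    have h1 : ‖w + c • ν - p‖ ≤ ‖w - p‖ + c := by
      calc ‖w + c • ν - p‖ = ‖(w - p) + c • ν‖ := by congr 1; abel
        _ ≤ ‖w - p‖ + ‖c • ν‖ := norm_add_le _ _
        _ = _ := by rw [norm_smul, hν, Real.norm_of_nonneg hc0, mul_one]
    have h2 : u ≤ K * (2 * s) := mul_le_mul_of_nonneg_left hyx.le hK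
    linarith
  have hseg : ∀ w ∈ ball p s, w ∈ Ω → ∀ c, 0 ≤ c → c ≤ u → w + c • ν ∈ Ω := by
    intro w hw hwΩ c hc0 hcu
    rw [hmem _ (hball w hw c hc0 hcu), hGν]
    have := (hmem w (ball_subset_ball hsr hw)).1 hwΩ
    linarith
  refine ⟨x + u • ν, y + u • ν, ?_, ?_⟩
  · rintro z ((hz | hz) | hz)
    · rw [segment_eq_image'] at hz
      obtain ⟨θ, ⟨h0, h1⟩, rfl⟩ := hz
      simp only [add_sub_cancel_left, smul_smul]
      exact hseg x hxp hx _ (mul_nonneg h0 hu0) (mul_le_of_le_one_left hu0 h1)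
    · rw [segment_eq_image'] at hz
      obtain ⟨θ, ⟨h0, h1⟩, rfl⟩ := hz
      have e : x + u • ν + θ • (y + u • ν - (x + u • ν)) = (x + θ • (y - x)) + u • ν := by
        module
      simp only [e]
      have hw : x + θ • (y - x) ∈ ball p s :=
        (convex_ball p s).segment_subset hxp hyp (by
          rw [segment_eq_image']; exact ⟨θ, ⟨h0, h1⟩, rfl⟩)
      rw [hmem _ (hball _ hw u hu0 le_rfl), hGν]
      have h2 := hLip _ (ball_subset_ball hsr hw) x (ball_subset_ball hsr hxp)
      rw [add_sub_cancel_left, norm_smul, Real.norm_of_nonneg h0] at h2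
      have h3 := (hmem x (ball_subset_ball hsr hxp)).1 hx
      have h4 : K * (θ * ‖y - x‖) ≤ u := by
        rw [hu]
        exact mul_le_mul_of_nonneg_left (mul_le_of_le_one_left (norm_nonneg _) h1) hK
      have := (abs_le.1 h2).2
      linarith
    · rw [segment_symm, segment_eq_image'] at hz
      obtain ⟨θ, ⟨h0, h1⟩, rfl⟩ := hz
      simp only [add_sub_cancel_left, smul_smul]
      exact hseg y hyp hy _ (mul_nonneg h0 hu0) (mul_le_of_le_one_left hu0 h1)
  · have e1 : x + u • ν - x = u • ν := by abel
    have e2 : y + u • ν - (x + u • ν) = y - x := by abel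
    have e3 : y - (y + u • ν) = -(u • ν) := by abel
    unfold polyLength
    rw [e1, e2, e3, norm_neg, norm_smul, hν, Real.norm_of_nonneg hu0]
    linarith

/-- The quadratic form is even, so `(2 s) v - w` differs from `w` in its value only by terms
carrying a factor `s`. -/
lemma abs_bilin_reflect_sub_le {B : Space d →L[ℝ] Space d →L[ℝ] ℝ} {v w : Space d} {K c s : ℝ}
    (hv : ‖v‖ = 1) (hK : 0 ≤ K) (hB : ∀ u w, |B u w| ≤ K * (‖u‖ * ‖w‖)) (hw : ‖w‖ ≤ c)
    (hs : |s| ≤ c) :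
    |B ((2 * s) • v - w) ((2 * s) • v - w) - B w w| ≤ 8 * K * c * |s| := by
  have e : B ((2 * s) • v - w) ((2 * s) • v - w) - B w w =
      (4 * (s * B v v) - 2 * B v w - 2 * B w v) * s := by
    simp only [map_sub, map_smul, FunLike.coe_sub, Pi.sub_apply, FunLike.coe_smul, Pi.smul_apply,
      smul_eq_mul]
    ring
  have b1 := hB v v
  have b2 := hB v w
  have b3 := hB w v
  simp only [hv, one_mul, mul_one] at b1 b2 b3
  have hwK : K * ‖w‖ ≤ K * c := mul_le_mul_of_nonneg_left hw hK
  have c1 : |s * B v v| ≤ K * c := by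
    rw [abs_mul, mul_comm K]
    exact mul_le_mul hs b1 (abs_nonneg _) ((abs_nonneg s).trans hs)
  have c2 := abs_le.1 (b2.trans hwK)
  have c3 := abs_le.1 (b3.trans hwK)
  have c1' := abs_le.1 c1
  rw [e, abs_mul]
  refine mul_le_mul_of_nonneg_right ?_ (abs_nonneg s)
  rw [abs_le]
  constructor <;> linarith

set_option maxHeartbeats 600000 in
/-- The rescaled domain differs from a half ball only in a thin neighbourhood of the hyperplane,
and from its reflection at the normal only in an even thinner neighbourhood of the boundary. -/
lemma HasGraphNear.blowup_estimates {p v : Space d} {K r : ℝ} (h : HasGraphNear Ω p v K r)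
    (hv : ‖v‖ = 1) (hK : 1 ≤ K) {ε δ : ℝ} (hε : 0 < ε) (hεr : 4 * ε < r) (hεK : 64 * K * ε ≤ 1)
    (hδ0 : 0 ≤ δ) (hδ : δ < 2 * ε) :
    (∀ z ∈ ball (0 : Space d) 2, ¬ (z ∈ blowup Ω ε (p - δ • v) ↔ z ∈ halfBall v (δ / ε)) →
      |δ / ε - inner ℝ v z| ≤ 80 * K * ε) ∧
    ∃ (ν : Space d) (G : Space d → ℝ), ‖ν‖ = 1 ∧ Continuous G ∧
      (∀ y (u : ℝ), G (y + u • ν) = G y - u) ∧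
      ∀ z ∈ ball (0 : Space d) 2, ¬ (z ∈ blowup Ω ε (p - δ • v) ↔
        (Submodule.span ℝ {v}).reflection z ∈ blowup Ω ε (p - δ • v)) →
        |G z| ≤ 13440 * K ^ 2 * ε ^ 2 := by
  obtain ⟨ν, G, hν, hGc, hGν, hmem, -, a, B, ha, hB, hG⟩ := h
  set x := p - δ • v with hx
  have hε1 : ε ≤ 1 := by nlinarith
  have hvv : inner ℝ v v = (1 : ℝ) := by rw [real_inner_self_eq_norm_sq, hv]; norm_num
  have hBb : ∀ u w, |B u w| ≤ K * (‖u‖ * ‖w‖) := fun u w => by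
    have := B.le_opNorm₂ u w
    rw [Real.norm_eq_abs, mul_assoc] at this
    exact this.trans (mul_le_mul_of_nonneg_right hB (by positivity))
  have hshift : ∀ z, x + ε • z = p + (ε • z - δ • v) := fun z => by rw [hx]; abel
  have hnorm : ∀ z ∈ ball (0 : Space d) 2, ‖ε • z - δ • v‖ < 4 * ε := by
    intro z hz
    rw [mem_ball_zero_iff] at hz
    calc ‖ε • z - δ • v‖ ≤ ‖ε • z‖ + ‖δ • v‖ := norm_sub_le _ _
      _ = ε * ‖z‖ + δ := by
        rw [norm_smul, norm_smul, hv, Real.norm_of_nonneg hε.le, Real.norm_of_nonneg hδ0, mul_one]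
      _ < 4 * ε := by nlinarith
  have hs : ∀ z, inner ℝ v (ε • z - δ • v) = ε * inner ℝ v z - δ := fun z => by
    rw [inner_sub_right, inner_smul_right, inner_smul_right, hvv, mul_one]
  have hmem' : ∀ z ∈ ball (0 : Space d) 2, (z ∈ blowup Ω ε x ↔ G (x + ε • z) < 0) := by
    intro z hz
    have : x + ε • z ∈ ball p r := by
      rw [hshift, mem_ball, dist_self_add_left]
      exact (hnorm z hz).trans hεr
    rw [← hmem _ this]
    exact ⟨fun h => h.2, fun h => ⟨hz, h⟩⟩
  have hG1 : ∀ z ∈ ball (0 : Space d) 2, |G (x + ε • z) - a * (ε * inner ℝ v z - δ) -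
      B (ε • z - δ • v) (ε • z - δ • v)| ≤ 64 * K * ε ^ 3 := by
    intro z hz
    have h1 := hG _ ((hnorm z hz).trans hεr)
    rw [← hshift, hs] at h1
    refine h1.trans ?_
    have : ‖ε • z - δ • v‖ ^ 3 ≤ (4 * ε) ^ 3 := pow_le_pow_left₀ (norm_nonneg _) (hnorm z hz).le 3
    nlinarith
  have hB1 : ∀ z ∈ ball (0 : Space d) 2,
      |B (ε • z - δ • v) (ε • z - δ • v)| ≤ 16 * K * ε ^ 2 := by
    intro z hz
    refine (hBb _ _).trans ?_
    have := hnorm z hz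
    have h2 : ‖ε • z - δ • v‖ * ‖ε • z - δ • v‖ ≤ (4 * ε) * (4 * ε) :=
      mul_le_mul this.le this.le (norm_nonneg _) (by positivity)
    nlinarith
  have hG2 : ∀ z ∈ ball (0 : Space d) 2, |G (x + ε • z) - a * (ε * inner ℝ v z - δ)|
      ≤ 80 * K * ε ^ 2 := by
    intro z hz
    have h1 := abs_le.1 (hG1 z hz)
    have h2 := abs_le.1 (hB1 z hz)
    have h3 : 64 * K * ε ^ 3 ≤ 64 * K * ε ^ 2 := by
      have : ε ^ 3 ≤ ε ^ 2 := pow_le_pow_of_le_one hε.le hε1 (by norm_num)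
      nlinarith
    rw [abs_le]
    constructor <;> linarith
  constructor
  · intro z hz hne
    rw [hmem' z hz] at hne
    have hH : z ∈ halfBall v (δ / ε) ↔ ε * inner ℝ v z - δ < 0 := by
      rw [sub_neg, mul_comm, ← lt_div_iff₀ hε]
      exact ⟨fun h => h.2, fun h => ⟨hz, h⟩⟩
    rw [hH] at hne
    set s := ε * inner ℝ v z - δ with hs'
    -- Here `s` and `G` have different signs while `G = a s + O(ε²)` with `a ≥ 1`, which forces `s =
    -- O(ε²)`.
    have h1 := abs_le.1 (hG2 z hz)
    have h2 : |s| ≤ 80 * K * ε ^ 2 := by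
      rcases lt_or_ge s 0 with h3 | h3
      · have h4 : 0 ≤ G (x + ε • z) := by by_contra h; exact hne ⟨fun _ => h3, fun _ => by linarith⟩
        rw [abs_of_neg h3]; nlinarith
      · have h4 : G (x + ε • z) < 0 := by
          by_contra h; exact hne ⟨fun h' => absurd h' h, fun h' => by linarith⟩
        rw [abs_of_nonneg h3]; nlinarith
    have h5 : δ / ε - inner ℝ v z = -s / ε := by rw [hs']; field_simp; ring
    rw [h5, abs_div, abs_neg, abs_of_pos hε, div_le_iff₀ hε]
    linarith
  · refine ⟨ν, fun z => G (x + ε • z) / ε, hν, by fun_prop, fun y u => ?_, fun z hz hne => ?_⟩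
    · have : x + ε • (y + u • ν) = x + ε • y + (ε * u) • ν := by module
      simp only [this, hGν, sub_div, mul_div_cancel_left₀ _ hε.ne']
    set R := (Submodule.span ℝ {v}).reflection with hR
    have hRz : R z = (2 * inner ℝ v z) • v - z := by
      rw [hR, Submodule.reflection_singleton_apply, hv]
      simp [two_smul, two_mul, add_smul]
    have hRzb : R z ∈ ball (0 : Space d) 2 := by
      rw [mem_ball_zero_iff, LinearIsometryEquiv.norm_map, ← mem_ball_zero_iff]; exact hz
    have hRin : inner ℝ v (R z) = inner ℝ v z := by
      rw [hRz, inner_sub_right, inner_smul_right, hvv]; ring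
    rw [hmem' z hz, hmem' (R z) hRzb] at hne
    have g1 := abs_le.1 (hG1 z hz)
    have g2 := abs_le.1 (hG1 (R z) hRzb)
    have g3 := abs_le.1 (hG2 z hz)
    rw [hRin] at g2
    set s := ε * inner ℝ v z - δ with hs'
    set w := ε • z - δ • v with hw
    have hRw : ε • R z - δ • v = (2 * s) • v - w := by
      rw [hRz, hw, hs']; module
    have hwn : ‖w‖ < 4 * ε := hnorm z hz
    have hsw : |s| ≤ 4 * ε := by
      have := abs_real_inner_le_norm v w
      rw [hv, one_mul, hs z] at this
      exact this.trans hwn.le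
    have hBd : |B (ε • R z - δ • v) (ε • R z - δ • v) - B w w| ≤ 32 * K * ε * |s| := by
      rw [hRw]
      refine (abs_bilin_reflect_sub_le hv (by linarith) hBb hwn.le hsw).trans_eq (by ring)
    -- Exactly one of the two points is in `Ω`, so `G` changes sign between them and `|G|` is at
    -- most the difference, in which the term `a s` cancels.
    have hdiff : |G (x + ε • z)| ≤ |G (x + ε • z) - G (x + ε • R z)| := by
      rcases lt_or_ge (G (x + ε • z)) 0 with h3 | h3
      · have h4 : 0 ≤ G (x + ε • R z) := by by_contra h; exact hne ⟨fun _ => by linarith, fun _ => h3⟩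
        rw [abs_of_neg h3, abs_of_nonpos (by linarith)]; linarith
      · have h4 : G (x + ε • R z) < 0 := by
          by_contra h; exact hne ⟨fun h' => by linarith, fun h' => absurd h' h⟩
        rw [abs_of_nonneg h3, abs_of_nonneg (by linarith)]; linarith
    have hg : |G (x + ε • z)| ≤ 128 * K * ε ^ 3 + 32 * K * ε * |s| := by
      refine hdiff.trans ?_
      have := abs_le.1 hBd
      rw [abs_le]
      constructor <;> linarith
    -- The term `32 K ε |s|` is absorbed since `64 K ε ≤ 1`; this leaves `416 = 2 (128 + 80)`.
    -- Feeding the bound back gives `13440 = 128 + 32 · 416`.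
    have hsb : |s| ≤ 416 * K * ε ^ 2 := by
      have h1 : a * |s| ≤ |G (x + ε • z)| + 80 * K * ε ^ 2 := by
        rw [← abs_of_pos (show 0 < a by linarith), ← abs_mul]
        have := abs_sub_abs_le_abs_sub (a * s) (G (x + ε • z))
        rw [abs_sub_comm] at this
        linarith [hG2 z hz]
      have h2 : |s| ≤ a * |s| := le_mul_of_one_le_left (abs_nonneg _) ha
      have h3 : 32 * K * ε * |s| ≤ 1 / 2 * |s| :=
        mul_le_mul_of_nonneg_right (by linarith) (abs_nonneg _)
      have h4 : 128 * K * ε ^ 3 ≤ 128 * K * ε ^ 2 := by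
        have : ε ^ 3 ≤ ε ^ 2 := pow_le_pow_of_le_one hε.le hε1 (by norm_num)
        nlinarith
      linarith
    rw [abs_div, abs_of_pos hε, div_le_iff₀ hε]
    have h5 : 32 * K * ε * |s| ≤ 32 * K * ε * (416 * K * ε ^ 2) :=
      mul_le_mul_of_nonneg_left hsb (by positivity)
    have h6 : 128 * K * ε ^ 3 ≤ 128 * K ^ 2 * ε ^ 3 := by
      have : 0 < ε ^ 3 := by positivity
      nlinarith
    linarith

end NonlocalLaplacian

/-! ### The estimates at scale `ε`, in the interior and near the boundary -/

namespace NonlocalLaplacian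

open MeasureTheory Metric Set Filter Topology

variable {d : ℕ} {Ω : Set (Space d)} {η : ℝ → ℝ} {n : Space d → Space d}

/-- The geometric facts about `Ω` at scale `ε` around `x` that enter the expansion of the nonlocal
Laplacian: points at distance less than `2 ε` are joined to `x` by short paths in `Ω`, the first
moments of the kernel tangential to `n x` are of order `ε²`, and the second moments agree up to
order `ε` with those of a half space. -/
structure LocalEstimates (hd : 2 ≤ d) (Ω : Set (Space d)) (η : ℝ → ℝ) (n : Space d → Space d)
    (K ε : ℝ) (x : Space d) : Prop where
  path : ∀ z ∈ blowup Ω ε x, ∃ a b, polyPath x a b (x + ε • z) ⊆ Ω ∧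
    polyLength x a b (x + ε • z) ≤ K * ‖ε • z‖
  first_moment : ∀ ℓ : Space d →L[ℝ] ℝ,
    |∫ z in blowup Ω ε x, η ‖z‖ * (ℓ z - inner ℝ (n x) z * ℓ (n x))| ≤ K * ε ^ 2 * ‖ℓ‖
  second_moment : ∀ Q : Space d →L[ℝ] Space d →L[ℝ] ℝ,
    |(∫ z in blowup Ω ε x, η ‖z‖ * Q z z) - (sigma1 hd η (bdryDist Ω x / ε) *
      ∑ i, Q (EuclideanSpace.single i 1) (EuclideanSpace.single i 1) +
      sigma2 hd η (bdryDist Ω x / ε) * Q (n x) (n x))| ≤ K * ε * ‖Q‖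
  sigma2_mul : sigma2 hd η (bdryDist Ω x / ε) • fderiv ℝ n x (n x) = 0

lemma LocalEstimates.mono {hd : 2 ≤ d} {K K' ε : ℝ} {x : Space d}
    (h : LocalEstimates hd Ω η n K ε x) (hε : 0 < ε) (hK : K ≤ K') :
    LocalEstimates hd Ω η n K' ε x where
  path z hz := by
    obtain ⟨a, b, h1, h2⟩ := h.path z hz
    exact ⟨a, b, h1, h2.trans (mul_le_mul_of_nonneg_right hK (norm_nonneg _))⟩
  first_moment ℓ := (h.first_moment ℓ).trans (by gcongr)
  second_moment Q := (h.second_moment Q).trans (by gcongr)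
  sigma2_mul := h.sigma2_mul

/-- The interior case: the ball of radius `2 ε` about `x` is contained in `Ω`. -/
lemma IsKernel.localEstimates_interior (hη : IsKernel η) (hd : 2 ≤ d) (hΩ : IsOpen Ω) {ε : ℝ}
    (hε : 0 < ε) {x : Space d} (hx : x ∈ Ω) (h : 2 * ε ≤ bdryDist Ω x) (n : Space d → Space d) :
    LocalEstimates hd Ω η n 1 ε x := by
  have hball : ∀ z ∈ ball (0 : Space d) 2, x + ε • z ∈ ball x (bdryDist Ω x) := by
    intro z hz
    rw [mem_ball_zero_iff] at hz
    rw [mem_ball, dist_self_add_left, norm_smul, Real.norm_of_nonneg hε.le]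
    nlinarith
  have hδ : 0 < bdryDist Ω x := by linarith
  have hsub := ball_bdryDist_subset hΩ hx hδ
  have hD : blowup Ω ε x = ball 0 2 :=
    Set.Subset.antisymm (blowup_subset Ω ε x) fun z hz => ⟨hz, hsub (hball z hz)⟩
  have ht : 2 ≤ bdryDist Ω x / ε := by rwa [le_div_iff₀ hε]
  have hσ := hη.sigma2_eq_zero hd ht
  refine ⟨fun z hz => ⟨x, x, ?_, ?_⟩, fun ℓ => ?_, fun Q => ?_, by rw [hσ, zero_smul]⟩
  · rw [polyPath_self_self]
    exact ((convex_ball x _).segment_subset (mem_ball_self hδ)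
      (hball z (blowup_subset Ω ε x hz))).trans hsub
  · rw [polyLength_self_self, add_sub_cancel_left, one_mul]
  · have h1 := integral_ball_odd η (ℓ - ℓ (n x) • innerSL ℝ (n x))
    have h2 : ∀ z, (ℓ - ℓ (n x) • innerSL ℝ (n x)) z = ℓ z - inner ℝ (n x) z * ℓ (n x) := by
      intro z
      simp [mul_comm]
    simp only [h2] at h1
    rw [hD, h1, abs_zero]
    positivity
  -- The half ball is the full ball, so any unit vector serves; `n x` need not have norm one in the
  -- interior.
  · have hv : ‖(EuclideanSpace.single (firstIdx hd) 1 : Space d)‖ = 1 := by simp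
    have h1 := hη.integral_halfBall_bilin hd hv (bdryDist Ω x / ε) Q
    rw [halfBall_eq_ball hv ht, hσ, zero_mul, add_zero] at h1
    rw [hD, h1, hσ, zero_mul, add_zero, sub_self, abs_zero]
    positivity

/-- Along the segment from `x` towards its nearest point `p` the distance to the boundary drops at
unit speed. So `p` remains nearest and `n` is constant there; the one-sided derivative determines
`Dn n`. -/
lemma IsNormalExtension.fderiv_apply_self_eq_zero (hn : IsNormalExtension Ω n)
    (hΩ : IsAdmissibleDomain Ω) (hd : 2 ≤ d) : ∃ r > 0, ∀ x ∈ Ω, bdryDist Ω x ≤ r →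
      (∀ p ∈ frontier Ω, dist x p = bdryDist Ω x → n x = n p) ∧ fderiv ℝ n x (n x) = 0 := by
  obtain ⟨r, hr, h⟩ := hn.eq_nearest
  refine ⟨r, hr, fun x hx hxr => ⟨h x hx hxr, ?_⟩⟩
  obtain ⟨p, hp, hxp⟩ := hΩ.exists_nearest hd x
  have hδ := hΩ.bdryDist_pos hd hx
  set δ := bdryDist Ω x with hδ'
  have hnx := h x hx hxr p hp hxp
  have hv := hn.outward p hp
  have hxe := sub_eq_smul_normal hΩ.isOpen hx hp hxp hδ hv
  rw [← hδ'] at hxe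
  have hconst : ∀ t ∈ Set.Ico (0 : ℝ) δ, n (x + t • n x) = n p := by
    rintro t ⟨ht0, htδ⟩
    have hd1 : dist (x + t • n x) x = t := by
      rw [dist_self_add_left, norm_smul, hnx, hv.norm_eq_one, mul_one, Real.norm_of_nonneg ht0]
    have hmem : x + t • n x ∈ Ω :=
      ball_bdryDist_subset hΩ.isOpen hx hδ (by rw [mem_ball, hd1]; exact htδ)
    have hd2 : dist (x + t • n x) p = δ - t := by
      have e : x + t • n x - p = -((δ - t) • n p) := by
        rw [hnx]; nth_rewrite 1 [hxe]; module
      rw [dist_eq_norm, e, norm_neg, norm_smul, hv.norm_eq_one, mul_one,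
        Real.norm_of_nonneg (by linarith)]
    have hd3 : bdryDist Ω (x + t • n x) = δ - t := by
      refine le_antisymm ((infDist_le_dist_of_mem hp).trans hd2.le) ?_
      have := infDist_le_infDist_add_dist (s := frontier Ω) (x := x) (y := x + t • n x)
      rw [dist_comm, hd1] at this
      change δ ≤ _ at this
      unfold bdryDist
      linarith
    exact h _ hmem (by rw [hd3]; linarith) p hp (by rw [hd2, hd3])
  have hdiff : HasFDerivAt n (fderiv ℝ n x) x :=
    ((hn.contDiffOn.differentiableOn (by norm_num)).differentiableAt
      (hΩ.isOpen.mem_nhds hx)).hasFDerivAt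
  have h1 : HasDerivWithinAt (fun t : ℝ => n (x + t • n x)) (fderiv ℝ n x (n x)) (Set.Ico 0 δ) 0 :=
    (hdiff.hasLineDerivAt (n x)).hasDerivWithinAt
  have h2 : HasDerivWithinAt (fun t : ℝ => n (x + t • n x)) 0 (Set.Ico 0 δ) 0 :=
    (hasDerivWithinAt_const (0 : ℝ) (Set.Ico 0 δ) (n p)).congr hconst
      (hconst 0 ⟨le_rfl, hδ⟩)
  have hu : UniqueDiffWithinAt ℝ (Set.Ico 0 δ) 0 := uniqueDiffOn_Ico 0 δ 0 ⟨le_rfl, hδ⟩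
  exact hu.eq_deriv _ h1 h2

/-- The vector field and its derivative along itself are bounded. -/
lemma IsNormalExtension.exists_bound (hn : IsNormalExtension Ω n) (hΩ : IsAdmissibleDomain Ω)
    (hd : 2 ≤ d) : ∃ M : ℝ, 0 ≤ M ∧ ∀ x ∈ Ω, ‖n x‖ ≤ M ∧ ‖fderiv ℝ n x (n x)‖ ≤ M := by
  obtain ⟨r, hr, h⟩ := hn.fderiv_apply_self_eq_zero hΩ hd
  -- No bound on `n` up to the boundary is assumed. Compactness of `S` handles the interior, while
  -- within distance `r` of the boundary `n` has norm one and `Dn n = 0`.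
  set S : Set (Space d) := closure Ω ∩ {x | r ≤ bdryDist Ω x} with hS
  have hcomp : IsCompact S := hΩ.isBounded.isCompact_closure.inter_right
    (isClosed_le continuous_const (continuous_infDist_pt _))
  have hSΩ : S ⊆ Ω := by
    rintro x ⟨hx1, hx2⟩
    by_contra hx
    have hxf : x ∈ frontier Ω := by rw [hΩ.isOpen.frontier_eq]; exact ⟨hx1, hx⟩
    have h0 : bdryDist Ω x = 0 := infDist_zero_of_mem hxf
    have hx2 : r ≤ bdryDist Ω x := hx2
    linarith
  have hc1 : ContinuousOn n S := hn.contDiffOn.continuousOn.mono hSΩ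
  have hc2 : ContinuousOn (fderiv ℝ n) S :=
    (hn.contDiffOn.continuousOn_fderiv_of_isOpen hΩ.isOpen (by norm_num)).mono hSΩ
  obtain ⟨M1, hM1⟩ := hcomp.exists_bound_of_continuousOn hc1
  obtain ⟨M2, hM2⟩ := hcomp.exists_bound_of_continuousOn (hc2.clm_apply hc1)
  refine ⟨max 1 (max M1 M2), le_trans zero_le_one (le_max_left _ _), fun x hx => ?_⟩
  rcases le_or_gt (bdryDist Ω x) r with h1 | h1
  · obtain ⟨p, hp, hxp⟩ := hΩ.exists_nearest hd x
    obtain ⟨h2, h3⟩ := h x hx h1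
    rw [h3, h2 p hp hxp, (hn.outward p hp).norm_eq_one, norm_zero]
    exact ⟨le_max_left _ _, le_trans zero_le_one (le_max_left _ _)⟩
  · have hxS : x ∈ S := ⟨subset_closure hx, h1.le⟩
    exact ⟨(hM1 x hxS).trans ((le_max_left _ _).trans (le_max_right _ _)),
      (hM2 x hxS).trans ((le_max_right _ _).trans (le_max_right _ _))⟩

lemma abs_apply_sub_inner_mul_le {v : Space d} (hv : ‖v‖ = 1) (ℓ : Space d →L[ℝ] ℝ) {z : Space d}
    (hz : ‖z‖ ≤ 2) : |ℓ z - inner ℝ v z * ℓ v| ≤ 4 * ‖ℓ‖ := by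
  have h1 : |ℓ z| ≤ ‖ℓ‖ * 2 := (ℓ.le_opNorm z).trans (by gcongr)
  have h2 : |ℓ v| ≤ ‖ℓ‖ := by simpa [hv] using ℓ.le_opNorm v
  have h3 : |inner ℝ v z| ≤ 2 := by
    have := abs_real_inner_le_norm v z
    rw [hv, one_mul] at this
    exact this.trans hz
  calc |ℓ z - inner ℝ v z * ℓ v| ≤ |ℓ z| + |inner ℝ v z * ℓ v| := abs_sub _ _
    _ ≤ ‖ℓ‖ * 2 + 2 * ‖ℓ‖ := by
        rw [abs_mul]
        gcongr
    _ = _ := by ring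

/-- The boundary case: `x` is at distance less than `2 ε` from the boundary, and `ε` is small. -/
lemma IsKernel.exists_localEstimates_boundary (hη : IsKernel η) (hd : 2 ≤ d)
    (hΩ : IsAdmissibleDomain Ω) (hn : IsNormalExtension Ω n) :
    ∃ K ε₀ : ℝ, 0 < ε₀ ∧ ∀ ε, 0 < ε → ε ≤ ε₀ → ∀ x ∈ Ω, bdryDist Ω x < 2 * ε →
      LocalEstimates hd Ω η n K ε x := by
  obtain ⟨K₁, r₁, hr₁, hgr⟩ := hΩ.exists_hasGraphNear
  obtain ⟨r₂, hr₂, hn2⟩ := hn.fderiv_apply_self_eq_zero hΩ hd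
  obtain ⟨C, hC, hslab⟩ := exists_volume_slab_le d
  set K := max K₁ 1 with hKdef
  have hK : 1 ≤ K := le_max_right _ _
  have hη0 := hη.zero_pos
  -- The summands serve, in order, the path length, the second moments and the first moments.
  set K' := (1 + 2 * K) + η 0 * 8 * (C * (80 * K)) + 4 * η 0 * (C * (13440 * K ^ 2)) with hK'
  have p1 : 0 ≤ η 0 * 8 * (C * (80 * K)) := by positivity
  have p2 : 0 ≤ 4 * η 0 * (C * (13440 * K ^ 2)) := by positivity
  -- The four thresholds keep the blow-up inside the chart, allow the absorption of `32 K ε |s|`,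
  -- put `x` where `n` is constant along normals, and leave room for the lifted paths.
  refine ⟨K', min (min (r₁ / 8) (1 / (64 * K))) (min (r₂ / 2) (r₁ / (4 * (1 + 2 * K)))),
    by positivity, fun ε hε hεε x hx hxε => ?_⟩
  have hε1 : ε ≤ r₁ / 8 := hεε.trans ((min_le_left _ _).trans (min_le_left _ _))
  have hε2 : ε ≤ 1 / (64 * K) := hεε.trans ((min_le_left _ _).trans (min_le_right _ _))
  have hε3 : ε ≤ r₂ / 2 := hεε.trans ((min_le_right _ _).trans (min_le_left _ _))
  have hε4 : ε ≤ r₁ / (4 * (1 + 2 * K)) := hεε.trans ((min_le_right _ _).trans (min_le_right _ _))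
  rw [le_div_iff₀ (by positivity)] at hε2 hε4
  obtain ⟨p, hp, hxp⟩ := hΩ.exists_nearest hd x
  have hδ := hΩ.bdryDist_pos hd hx
  obtain ⟨hnx, hDn⟩ := hn2 x hx (by linarith)
  have hnx := hnx p hp hxp
  have hout := hn.outward p hp
  have hxe := sub_eq_smul_normal hΩ.isOpen hx hp hxp hδ hout
  rw [← hnx] at hout hxe
  set v := n x with hv
  set δ := bdryDist Ω x with hδ'
  have hv1 : ‖v‖ = 1 := hout.norm_eq_one
  have hg : HasGraphNear Ω p v K r₁ := (hgr p hp v hout).mono (le_max_left _ _) le_rfl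
  obtain ⟨hhalf, ν, G, hν, hGc, hGν, hrefl⟩ :=
    hg.blowup_estimates hv1 hK hε (by linarith) (by linarith) hδ.le hxε
  rw [← hxe] at hhalf hrefl
  have hDm : MeasurableSet (blowup Ω ε x) := (isOpen_blowup hΩ.isOpen ε x).measurableSet
  have hDb := blowup_subset Ω ε x
  refine ⟨fun z hz => ?_, fun ℓ => ?_, fun Q => ?_, by rw [hDn, smul_zero]⟩
  · have hxb : x ∈ ball p (4 * ε) := by rw [mem_ball, hxp]; linarith
    have hzn : ‖z‖ < 2 := mem_ball_zero_iff.1 hz.1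
    have hyb : x + ε • z ∈ ball p (4 * ε) := by
      have h1 : dist (x + ε • z) x = ε * ‖z‖ := by
        rw [dist_self_add_left, norm_smul, Real.norm_of_nonneg hε.le]
      rw [mem_ball]
      have := dist_triangle (x + ε • z) x p
      nlinarith
    obtain ⟨a, b, hab, hlen⟩ := hg.exists_polyPath (by linarith) (s := 4 * ε) (by linarith)
      hx hz.2 hxb hyb
    rw [add_sub_cancel_left] at hlen
    refine ⟨a, b, hab, hlen.trans (mul_le_mul_of_nonneg_right ?_ (norm_nonneg _))⟩
    linarith
  · set f : Space d → ℝ := fun z => η ‖z‖ * (ℓ z - inner ℝ v z * ℓ v) with hf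
    have hfi : IntegrableOn f (ball 0 2) := hη.integrableOn_mul (by fun_prop)
    have hfb : ∀ z ∈ ball (0 : Space d) 2, |f z| ≤ η 0 * (4 * ‖ℓ‖) := by
      intro z hz
      rw [hf, abs_mul]
      exact mul_le_mul (hη.abs_norm_le z)
        (abs_apply_sub_inner_mul_le hv1 ℓ (mem_ball_zero_iff.1 hz).le) (abs_nonneg _) hη0.le
    set R := (Submodule.span ℝ {v}).reflection with hR
    have hRz : ∀ z, R z = (2 * inner ℝ v z) • v - z := fun z => by
      rw [hR, Submodule.reflection_singleton_apply, hv1]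
      simp [two_smul, two_mul, add_smul]
    -- `f` depends on the direction through the tangential part of `z` alone, which `R` negates.
    -- Hence the integral is half the difference of the integrals over the domain and its mirror
    -- image.
    have hodd : ∀ z, f (R z) = - f z := by
      intro z
      have hRin : inner ℝ v (R z) = inner ℝ v z := by
        rw [hRz, inner_sub_right, inner_smul_right, real_inner_self_eq_norm_sq, hv1]; ring
      simp only [hf, LinearIsometryEquiv.norm_map, hRin]
      rw [hRz, map_sub, map_smul, smul_eq_mul]
      ring
    have h1 := setIntegral_preimage_linearIsometryEquiv R f (blowup Ω ε x)
    simp only [hodd, integral_neg] at h1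
    have hA := hslab ν G hν hGc hGν (13440 * K ^ 2 * ε ^ 2) (by positivity)
    have h2 := abs_setIntegral_sub_le (A := {z | z ∈ ball (0 : Space d) 2 ∧
        |G z| ≤ 13440 * K ^ 2 * ε ^ 2}) (T := R ⁻¹' blowup Ω ε x) hfi hDm
      (hDm.preimage R.continuous.measurable) hDb
      (fun z hz => by
        have := hDb hz
        rwa [mem_ball_zero_iff, LinearIsometryEquiv.norm_map, ← mem_ball_zero_iff] at this)
      (lt_of_le_of_lt (measure_mono fun z hz => hz.1) measure_ball_lt_top).ne hfb
      (fun z hz hne => ⟨hz, hrefl z hz hne⟩) (by positivity)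
    set I := ∫ z in blowup Ω ε x, f z with hI
    have h3 : I - ∫ z in R ⁻¹' blowup Ω ε x, f z = 2 * I := by linarith
    rw [h3, abs_mul, abs_of_pos (by norm_num : (0 : ℝ) < 2)] at h2
    have h4 : |I| ≤ η 0 * (4 * ‖ℓ‖) * (C * (13440 * K ^ 2 * ε ^ 2)) := by
      have : η 0 * (4 * ‖ℓ‖) * volume.real {z | z ∈ ball (0 : Space d) 2 ∧
        |G z| ≤ 13440 * K ^ 2 * ε ^ 2} ≤ η 0 * (4 * ‖ℓ‖) * (C * (13440 * K ^ 2 * ε ^ 2)) := by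
        gcongr
      linarith
    calc |I| ≤ (4 * η 0 * (C * (13440 * K ^ 2))) * ε ^ 2 * ‖ℓ‖ := by linarith
      _ ≤ K' * ε ^ 2 * ‖ℓ‖ := by
        gcongr
        linarith
  · set f : Space d → ℝ := fun z => η ‖z‖ * Q z z with hf
    have hfi : IntegrableOn f (ball 0 2) := hη.integrableOn_mul (by fun_prop)
    have hfb : ∀ z ∈ ball (0 : Space d) 2, |f z| ≤ η 0 * (‖Q‖ * 4) := by
      intro z hz
      rw [mem_ball_zero_iff] at hz
      rw [hf, abs_mul]
      have h1 : |Q z z| ≤ ‖Q‖ * 4 := by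
        have := Q.le_opNorm₂ z z
        rw [Real.norm_eq_abs, mul_assoc] at this
        have hz2 : ‖z‖ * ‖z‖ ≤ 4 := by nlinarith [norm_nonneg z]
        exact this.trans (mul_le_mul_of_nonneg_left hz2 (by positivity))
      exact mul_le_mul (hη.abs_norm_le z) h1 (abs_nonneg _) hη0.le
    have hvn : ‖-v‖ = 1 := by rw [norm_neg, hv1]
    -- A flat slab, regarded as a graph over the plane orthogonal to `-v`.
    have hA := hslab (-v) (fun z => inner ℝ v z - δ / ε) hvn (by fun_prop)
      (fun y u => by
        rw [inner_add_right, inner_smul_right, inner_neg_right, real_inner_self_eq_norm_sq, hv1]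
        ring) (80 * K * ε) (by positivity)
    have h2 := abs_setIntegral_sub_le (A := {z | z ∈ ball (0 : Space d) 2 ∧
        |inner ℝ v z - δ / ε| ≤ 80 * K * ε}) hfi hDm (isOpen_halfBall v (δ / ε)).measurableSet hDb
      (halfBall_subset v (δ / ε))
      (lt_of_le_of_lt (measure_mono fun z hz => hz.1) measure_ball_lt_top).ne hfb
      (fun z hz hne => ⟨hz, by rw [abs_sub_comm]; exact hhalf z hz hne⟩) (by positivity)
    rw [hη.integral_halfBall_bilin hd hv1] at h2
    refine h2.trans ?_
    calc _ ≤ 2 * (η 0 * (‖Q‖ * 4)) * (C * (80 * K * ε)) := by gcongr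
      _ = (η 0 * 8 * (C * (80 * K))) * ε * ‖Q‖ := by ring
      _ ≤ K' * ε * ‖Q‖ := by
        gcongr
        linarith

end NonlocalLaplacian

/-! ### Rewriting the differential operators in terms of moments -/

namespace NonlocalLaplacian

open MeasureTheory Metric Set Filter Topology

variable {d : ℕ} {Ω : Set (Space d)} {η : ℝ → ℝ} {n : Space d → Space d} {ρ φ : Space d → ℝ}

/-- The bilinear form `∇φ ⊗ ∇ρ + ½ ρ D²φ` whose moments against the kernel are the second order
terms of the nonlocal Laplacian. -/
noncomputable def secondOrderForm (ρ φ : Space d → ℝ) (x : Space d) :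
    Space d →L[ℝ] Space d →L[ℝ] ℝ :=
  (fderiv ℝ φ x).smulRight (fderiv ℝ ρ x) + (ρ x / 2) • fderiv ℝ (fderiv ℝ φ) x

lemma secondOrderForm_apply (ρ φ : Space d → ℝ) (x u w : Space d) :
    secondOrderForm ρ φ x u w =
      fderiv ℝ φ x u * fderiv ℝ ρ x w + ρ x / 2 * fderiv ℝ (fderiv ℝ φ) x u w := by
  simp [secondOrderForm]

set_option maxSynthPendingDepth 3 in
lemma norm_secondOrderForm_le (hb : Bornology.IsBounded Ω) (hρ : IsCkClosure 2 Ω ρ)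
    (hφ : IsCkClosure 3 Ω φ) {x : Space d} (hx : x ∈ Ω) :
    ‖secondOrderForm ρ φ x‖ ≤ 2 * ckNorm 2 Ω ρ * ckNorm 3 Ω φ := by
  have hR := ckNorm_nonneg 2 Ω ρ
  have hN := ckNorm_nonneg 3 Ω φ
  have h1 := hφ.norm_fderiv_le hb (by norm_num) hx
  have h2 := hφ.norm_fderiv_two_le hb (by norm_num) hx
  have h3 := hρ.norm_fderiv_le hb (by norm_num) hx
  have h4 := hρ.abs_le hb hx
  rw [secondOrderForm]
  refine le_trans (norm_add_le _ _) ?_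
  rw [ContinuousLinearMap.norm_smulRight_apply, norm_smul, Real.norm_eq_abs, abs_div,
    abs_of_pos (by norm_num : (0 : ℝ) < 2)]
  have a1 : ‖fderiv ℝ φ x‖ * ‖fderiv ℝ ρ x‖ ≤ ckNorm 3 Ω φ * ckNorm 2 Ω ρ :=
    mul_le_mul h1 h3 (norm_nonneg _) hN
  have a2 : |ρ x| / 2 * ‖fderiv ℝ (fderiv ℝ φ) x‖ ≤ ckNorm 2 Ω ρ / 2 * ckNorm 3 Ω φ :=
    mul_le_mul (by linarith) h2 (by positivity) (by linarith)
  have := mul_nonneg hR hN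
  linarith

lemma hasFDerivAt_of_contDiffOn {k : ℕ} {f : Space d → ℝ} (hΩ : IsOpen Ω)
    (hf : ContDiffOn ℝ k f Ω) (hk : k ≠ 0) {x : Space d} (hx : x ∈ Ω) :
    HasFDerivAt f (fderiv ℝ f x) x :=
  ((hf.differentiableOn (by exact_mod_cast hk)).differentiableAt (hΩ.mem_nhds hx)).hasFDerivAt

/-- The product rule gives `div (ρ² ∇φ) = 2 ρ tr Q`. -/
lemma weightedLaplacian_eq (hd : 2 ≤ d) (hΩ : IsOpen Ω) (hρ : ContDiffOn ℝ 2 ρ Ω)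
    (hφ : ContDiffOn ℝ 3 φ Ω) (η : ℝ → ℝ) {x : Space d} (hx : x ∈ Ω) (hρx : ρ x ≠ 0) :
    weightedLaplacian hd ρ η φ x = -(2 * sigmaEta hd η *
      ∑ i, secondOrderForm ρ φ x (EuclideanSpace.single i 1) (EuclideanSpace.single i 1)) := by
  have h1 := hasFDerivAt_of_contDiffOn (k := 2) hΩ hρ (by norm_num) hx
  have h2 := (differentiableAt_fderiv hΩ (hφ.of_le (by norm_num)) hx).hasFDerivAt
  let T : (Space d →L[ℝ] ℝ) →L[ℝ] Space d :=
    (InnerProductSpace.toDual ℝ (Space d)).symm.toLinearIsometry.toContinuousLinearMap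
  have hT : ∀ (ℓ : Space d →L[ℝ] ℝ) i, (T ℓ) i = ℓ (EuclideanSpace.single i 1) := by
    intro ℓ i
    have e1 : inner ℝ (T ℓ) (EuclideanSpace.single i 1) = ℓ (EuclideanSpace.single i 1) :=
      InnerProductSpace.toDual_symm_apply
    rw [← e1, EuclideanSpace.inner_single_right]
    simp
  have h3 : HasFDerivAt (fun y => gradient φ y) (T.comp (fderiv ℝ (fderiv ℝ φ) x)) x :=
    T.hasFDerivAt.comp x h2
  have h4 := (h1.pow 2).smul h3
  have h5 : divergence (fun y => ρ y ^ 2 • gradient φ y) x = 2 * ρ x *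
      ∑ i, secondOrderForm ρ φ x (EuclideanSpace.single i 1) (EuclideanSpace.single i 1) := by
    unfold divergence
    have h6 : fderiv ℝ (fun y => ρ y ^ 2 • gradient φ y) x = _ := h4.fderiv
    rw [h6, Finset.mul_sum]
    refine Finset.sum_congr rfl fun i _ => ?_
    have e2 : (gradient φ x) i = fderiv ℝ φ x (EuclideanSpace.single i 1) := hT _ i
    simp only [secondOrderForm_apply, _root_.add_apply, FunLike.coe_smul,
      Pi.smul_apply, ContinuousLinearMap.coe_comp, Function.comp_apply, PiLp.add_apply,
      PiLp.smul_apply, hT, smul_eq_mul, ContinuousLinearMap.smulRight_apply, e2]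
    ring
  rw [weightedLaplacian, h5]
  field_simp

lemma normalDeriv_eq (n : Space d → Space d) (f : Space d → ℝ) (x : Space d) :
    normalDeriv n f x = fderiv ℝ f x (n x) := by
  rw [normalDeriv, real_inner_comm, inner_gradient_eq_fderiv]

/-- The last term comes from differentiating `n` along itself; it is removed later by the factor
`σ₂` or by `Dn n = 0`. -/
lemma normalDeriv_normalDeriv_eq (hΩ : IsOpen Ω) (hρ : ContDiffOn ℝ 2 ρ Ω)
    (hφ : ContDiffOn ℝ 3 φ Ω) (hn : ContDiffOn ℝ 2 n Ω) {x : Space d} (hx : x ∈ Ω) :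
    normalDeriv n (fun y => ρ y ^ 2 * normalDeriv n φ y) x =
      2 * ρ x * secondOrderForm ρ φ x (n x) (n x) +
      ρ x ^ 2 * fderiv ℝ φ x (fderiv ℝ n x (n x)) := by
  have h1 := hasFDerivAt_of_contDiffOn (k := 2) hΩ hρ (by norm_num) hx
  have h2 := (differentiableAt_fderiv hΩ (hφ.of_le (by norm_num)) hx).hasFDerivAt
  have h3 : HasFDerivAt n (fderiv ℝ n x) x :=
    ((hn.differentiableOn (by norm_num)).differentiableAt (hΩ.mem_nhds hx)).hasFDerivAt
  have h4 := (h1.pow 2).mul (h2.clm_apply h3)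
  rw [normalDeriv_eq]
  simp only [normalDeriv_eq]
  have h5 : fderiv ℝ (fun y => ρ y ^ 2 * fderiv ℝ φ y (n y)) x = _ := h4.fderiv
  rw [h5, secondOrderForm_apply]
  simp
  ring

lemma gammaEps_eq (hη : IsKernel η) (hΩ : IsOpen Ω) (n : Space d → Space d) {ε : ℝ} (hε : 0 < ε)
    (x : Space d) :
    gammaEps Ω η n ε x = -∫ z in blowup Ω ε x, η ‖z‖ * inner ℝ (n x) z := by
  have h1 := setIntegral_etaEps_mul hη (isOpen_ball.inter hΩ : IsOpen (ball x (2 * ε) ∩ Ω)) hε x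
    (fun y => inner ℝ (x - y) (n x))
  have h2 : blowup (ball x (2 * ε) ∩ Ω) ε x = blowup Ω ε x := by
    ext z
    refine ⟨fun h => ⟨h.1, h.2.2⟩, fun h => ⟨h.1, ?_, h.2⟩⟩
    have := mem_ball_zero_iff.1 h.1
    rw [mem_ball, dist_self_add_left, norm_smul, Real.norm_of_nonneg hε.le]
    nlinarith
  rw [gammaEps, h1, h2]
  have h3 : ∀ z : Space d, η ‖z‖ * inner ℝ (x - (x + ε • z)) (n x) =
      -ε * (η ‖z‖ * inner ℝ (n x) z) := by
    intro z
    rw [sub_add_cancel_left, inner_neg_left, inner_smul_left, real_inner_comm]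
    simp
    ring
  simp only [h3, integral_const_mul]
  field_simp

lemma nonlocalLaplacian_eq (hη : IsKernel η) (hΩ : IsOpen Ω) (ρ φ : Space d → ℝ) {ε : ℝ}
    (hε : 0 < ε) (x : Space d) :
    nonlocalLaplacian Ω ρ η ε φ x = 2 / ε ^ 2 *
      ∫ z in blowup Ω ε x, η ‖z‖ * ((φ x - φ (x + ε • z)) * ρ (x + ε • z)) := by
  rw [nonlocalLaplacian, ← setIntegral_etaEps_mul hη hΩ hε x (fun y => (φ x - φ y) * ρ y)]
  simp only [mul_assoc]

/-- The error in the product of the Taylor expansions of `u(x) - u(y)` and `ρ(y)`. -/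
lemma abs_taylor_mul_sub_le {A P α β q s ε K N R : ℝ} (hε : 0 < ε) (hε1 : ε ≤ 1) (hK : 1 ≤ K)
    (hN : 0 ≤ N) (hα : |α| ≤ 2 * N) (hβ : |β| ≤ 4 * N) (hq : |q| ≤ 2 * R) (hs : |s| ≤ R)
    (hA : |A + ε * α + 1 / 2 * ε ^ 2 * β| ≤ 8 * N * K ^ 3 * ε ^ 3)
    (hr : |s - P - ε * q| ≤ 4 * R * K ^ 2 * ε ^ 2) :
    |A * s + ε * P * α + ε ^ 2 * (α * q + P / 2 * β)| ≤ 28 * K ^ 3 * ε ^ 3 * N * R := by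
  have hR : 0 ≤ R := (abs_nonneg s).trans hs
  have hK2 : 1 ≤ K ^ 2 := one_le_pow₀ hK
  have hK3 : K ^ 2 ≤ K ^ 3 := pow_le_pow_right₀ hK (by norm_num)
  have hsP : |s - P| ≤ 6 * R * K ^ 2 * ε := by
    have h1 : s - P = (s - P - ε * q) + ε * q := by ring
    have h2 : |ε * q| ≤ ε * (2 * R) := by
      rw [abs_mul, abs_of_pos hε]; gcongr
    have h3 : ε ^ 2 ≤ ε := by nlinarith
    calc |s - P| ≤ |s - P - ε * q| + |ε * q| := by
          conv_lhs => rw [h1]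
          exact abs_add_le _ _
      _ ≤ 4 * R * K ^ 2 * ε + 2 * R * 1 * ε := by
          have : 4 * R * K ^ 2 * ε ^ 2 ≤ 4 * R * K ^ 2 * ε := by gcongr
          linarith
      _ ≤ 4 * R * K ^ 2 * ε + 2 * R * K ^ 2 * ε := by gcongr
      _ = _ := by ring
  -- Each term is a Taylor remainder times a bounded factor. The three bounds contribute `8`, `8`
  -- and `12`, hence `28`.
  have e : A * s + ε * P * α + ε ^ 2 * (α * q + P / 2 * β) =
      (A + ε * α + 1 / 2 * ε ^ 2 * β) * s - ε * (α * (s - P - ε * q)) -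
        1 / 2 * ε ^ 2 * (β * (s - P)) := by ring
  have t1 : |(A + ε * α + 1 / 2 * ε ^ 2 * β) * s| ≤ 8 * N * K ^ 3 * ε ^ 3 * R := by
    rw [abs_mul]; gcongr
  have t2 : |ε * (α * (s - P - ε * q))| ≤ ε * (2 * N * (4 * R * K ^ 2 * ε ^ 2)) := by
    rw [abs_mul, abs_mul, abs_of_pos hε]; gcongr
  have t3 : |1 / 2 * ε ^ 2 * (β * (s - P))| ≤ 1 / 2 * ε ^ 2 * (4 * N * (6 * R * K ^ 2 * ε)) := by
    rw [abs_mul (1 / 2 * ε ^ 2), abs_mul β, abs_of_pos (by positivity : 0 < 1 / 2 * ε ^ 2)]; gcongr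
  have t4 : 20 * (N * R * ε ^ 3) * K ^ 2 ≤ 20 * (N * R * ε ^ 3) * K ^ 3 := by gcongr
  rw [e]
  have b1 := abs_le.1 t1
  have b2 := abs_le.1 t2
  have b3 := abs_le.1 t3
  rw [abs_le]
  constructor <;> linarith

/-- The expression estimated in the expansion of the nonlocal Laplacian. -/
noncomputable def expansionError (hd : 2 ≤ d) (Ω : Set (Space d)) (ρ : Space d → ℝ) (η : ℝ → ℝ)
    (n : Space d → Space d) (ε : ℝ) (φ : Space d → ℝ) (x : Space d) : ℝ :=
  nonlocalLaplacian Ω ρ η ε φ x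
    - sigma1 hd η (bdryDist Ω x / ε) / sigmaEta hd η * weightedLaplacian hd ρ η φ x
    - 2 * ρ x * gammaEps Ω η n ε x / ε * normalDeriv n φ x
    + sigma2 hd η (bdryDist Ω x / ε) / ρ x *
      normalDeriv n (fun y => ρ y ^ 2 * normalDeriv n φ y) x

/-- An exact identity: all approximation is deferred to the moments and the Taylor remainder. -/
lemma expansionError_eq (hd : 2 ≤ d) (hΩ : IsOpen Ω) (hη : IsKernel η)
    (hρ : ContDiffOn ℝ 2 ρ Ω) (hφ : ContDiffOn ℝ 3 φ Ω) (hn : ContDiffOn ℝ 2 n Ω) {ε : ℝ}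
    (hε : 0 < ε) {x : Space d} (hx : x ∈ Ω) (hρx : ρ x ≠ 0) :
    expansionError hd Ω ρ η n ε φ x =
      2 / ε ^ 2 * (∫ z in blowup Ω ε x, η ‖z‖ * ((φ x - φ (x + ε • z)) * ρ (x + ε • z)))
      + 2 * (sigma1 hd η (bdryDist Ω x / ε) *
        ∑ i, secondOrderForm ρ φ x (EuclideanSpace.single i 1) (EuclideanSpace.single i 1)
        + sigma2 hd η (bdryDist Ω x / ε) * secondOrderForm ρ φ x (n x) (n x))
      + 2 * ρ x / ε * (∫ z in blowup Ω ε x, η ‖z‖ * inner ℝ (n x) z) * fderiv ℝ φ x (n x)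
      + ρ x * fderiv ℝ φ x (sigma2 hd η (bdryDist Ω x / ε) • fderiv ℝ n x (n x)) := by
  have hσ := (hη.sigmaEta_pos hd).ne'
  rw [expansionError, nonlocalLaplacian_eq hη hΩ ρ φ hε,
    weightedLaplacian_eq hd hΩ hρ hφ η hx hρx, gammaEps_eq hη hΩ n hε,
    normalDeriv_normalDeriv_eq hΩ hρ hφ hn hx, normalDeriv_eq, map_smul, smul_eq_mul]
  field_simp
  ring

lemma integrableOn_blowup (hη : IsKernel η) (hΩ : IsAdmissibleDomain Ω)
    (hρ : IsCkClosure 2 Ω ρ) (hφ : IsCkClosure 3 Ω φ) (ε : ℝ) (x : Space d) :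
    IntegrableOn (fun z => η ‖z‖ * ((φ x - φ (x + ε • z)) * ρ (x + ε • z))) (blowup Ω ε x) := by
  have hDm := (isOpen_blowup hΩ.isOpen ε x).measurableSet
  have hmap : ContinuousOn (fun z : Space d => x + ε • z) (blowup Ω ε x) := by fun_prop
  have hmt : Set.MapsTo (fun z : Space d => x + ε • z) (blowup Ω ε x) Ω := fun z hz => hz.2
  have hc : ContinuousOn (fun z => (φ x - φ (x + ε • z)) * ρ (x + ε • z)) (blowup Ω ε x) :=
    (continuousOn_const.sub (hφ.1.continuousOn.comp hmap hmt)).mul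
      (hρ.1.continuousOn.comp hmap hmt)
  have hfin : volume (blowup Ω ε x) ≠ ⊤ :=
    (lt_of_le_of_lt (measure_mono (blowup_subset Ω ε x)) measure_ball_lt_top).ne
  have hi : IntegrableOn (fun z => (φ x - φ (x + ε • z)) * ρ (x + ε • z)) (blowup Ω ε x) := by
    refine IntegrableOn.of_bound hfin.lt_top (hc.aestronglyMeasurable hDm)
      ((|φ x| + ckNorm 3 Ω φ) * ckNorm 2 Ω ρ) ?_
    refine (ae_restrict_iff' hDm).2 (Eventually.of_forall fun z hz => ?_)
    rw [norm_mul, Real.norm_eq_abs, Real.norm_eq_abs]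
    refine mul_le_mul ((abs_sub _ _).trans ?_) (hρ.abs_le hΩ.isBounded hz.2) (abs_nonneg _)
      (add_nonneg (abs_nonneg _) (ckNorm_nonneg 3 Ω φ))
    exact add_le_add_right (hφ.abs_le hΩ.isBounded hz.2) _
  exact Integrable.bdd_mul (c := η 0) hi hη.measurable_norm.aestronglyMeasurable
    (Eventually.of_forall fun z => hη.abs_norm_le z)

end NonlocalLaplacian

/-! ### Bounding the error for small and for large `ε` -/

namespace NonlocalLaplacian

open MeasureTheory Metric Set Filter Topology

variable {d : ℕ} {Ω : Set (Space d)} {η : ℝ → ℝ} {n : Space d → Space d} {ρ φ : Space d → ℝ}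

lemma abs_bilin_self_le (Q : Space d →L[ℝ] Space d →L[ℝ] ℝ) {z : Space d} {c : ℝ} (hz : ‖z‖ ≤ c) :
    |Q z z| ≤ ‖Q‖ * c ^ 2 := by
  have h1 := Q.le_opNorm₂ z z
  rw [Real.norm_eq_abs] at h1
  refine h1.trans ?_
  rw [mul_assoc, sq]
  have hc : 0 ≤ c := (norm_nonneg z).trans hz
  gcongr

lemma abs_clm_apply_le (ℓ : Space d →L[ℝ] ℝ) {z : Space d} {c : ℝ} (hz : ‖z‖ ≤ c) :
    |ℓ z| ≤ ‖ℓ‖ * c :=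
  (ℓ.le_opNorm z).trans (by gcongr)

lemma abs_setIntegral_kernel_mul_le (hη : IsKernel η) {S : Set (Space d)} (hS : S ⊆ ball 0 2)
    {g : Space d → ℝ} {c : ℝ} (hg : ∀ z ∈ S, |g z| ≤ c) (hc : 0 ≤ c) :
    |∫ z in S, η ‖z‖ * g z| ≤ η 0 * c * volume.real (ball (0 : Space d) 2) := by
  have hη0 := hη.zero_pos
  have hfin : volume S < ⊤ := lt_of_le_of_lt (measure_mono hS) measure_ball_lt_top
  have h := norm_setIntegral_le_of_norm_le_const (f := fun z => η ‖z‖ * g z) hfin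
    (C := η 0 * c) fun z hz => by
      rw [Real.norm_eq_abs, abs_mul]
      exact mul_le_mul (hη.abs_norm_le z) (hg z hz) (abs_nonneg _) hη0.le
  exact h.trans (mul_le_mul_of_nonneg_left (measureReal_mono hS measure_ball_lt_top.ne)
    (by positivity))

/-- The Taylor remainder of the integrand of the nonlocal Laplacian. -/
lemma LocalEstimates.abs_remainder_le {hd : 2 ≤ d} (hΩ : IsAdmissibleDomain Ω)
    (hρ : IsCkClosure 2 Ω ρ) (hφ : IsCkClosure 3 Ω φ) {K ε : ℝ} {x : Space d}
    (h : LocalEstimates hd Ω η n K ε x) (hK : 1 ≤ K) (hε : 0 < ε) (hε1 : ε ≤ 1) (hx : x ∈ Ω)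
    {z : Space d} (hz : z ∈ blowup Ω ε x) :
    |(φ x - φ (x + ε • z)) * ρ (x + ε • z) + ε * ρ x * fderiv ℝ φ x z +
      ε ^ 2 * secondOrderForm ρ φ x z z| ≤
      28 * K ^ 3 * ε ^ 3 * ckNorm 3 Ω φ * ckNorm 2 Ω ρ := by
  have hb := hΩ.isBounded
  have hzn : ‖z‖ ≤ 2 := (mem_ball_zero_iff.1 hz.1).le
  have hN := ckNorm_nonneg 3 Ω φ
  have hR := ckNorm_nonneg 2 Ω ρ
  obtain ⟨a, b, hab, hlen⟩ := h.path z hz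
  have hlen2 : polyLength x a b (x + ε • z) ≤ 2 * K * ε := by
    refine hlen.trans ?_
    rw [norm_smul, Real.norm_of_nonneg hε.le]
    nlinarith [mul_le_mul_of_nonneg_left hzn (mul_nonneg (by linarith : 0 ≤ K) hε.le)]
  have hL0 := polyLength_nonneg x a b (x + ε • z)
  have hTφ := abs_taylor_two_le hΩ.isOpen hφ.1 (M := ckNorm 3 Ω φ)
    (fun w hw => hφ.norm_fderiv_three_le hb le_rfl hw) hab
  have hTρ := abs_taylor_one_le hΩ.isOpen hρ.1 (M := ckNorm 2 Ω ρ)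
    (fun w hw => hρ.norm_fderiv_two_le hb le_rfl hw) hab
  simp only [add_sub_cancel_left, map_smul, FunLike.coe_smul, Pi.smul_apply, smul_eq_mul] at hTφ hTρ
  rw [secondOrderForm_apply]
  refine abs_taylor_mul_sub_le hε hε1 hK hN ?_ ?_ ?_ (hρ.abs_le hb hz.2) ?_ ?_
  · refine (abs_clm_apply_le _ hzn).trans ?_
    linarith [hφ.norm_fderiv_le hb (by norm_num) hx]
  · refine (abs_bilin_self_le _ hzn).trans ?_
    linarith [hφ.norm_fderiv_two_le hb (by norm_num) hx]
  · refine (abs_clm_apply_le _ hzn).trans ?_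
    linarith [hρ.norm_fderiv_le hb (by norm_num) hx]
  · calc _ = |φ (x + ε • z) - φ x - ε * fderiv ℝ φ x z -
          1 / 2 * (ε * (ε * fderiv ℝ (fderiv ℝ φ) x z z))| := by
          rw [← abs_neg]; congr 1; ring
      _ ≤ _ := hTφ
      _ ≤ ckNorm 3 Ω φ * (2 * K * ε) ^ 3 := by gcongr
      _ = _ := by ring
  · calc _ ≤ _ := hTρ
      _ ≤ ckNorm 2 Ω ρ * (2 * K * ε) ^ 2 := by gcongr
      _ = _ := by ring

/-- Three errors add up: the Taylor remainder gives `56 = 2 · 28`, and the second and first moments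
give `4 K` and `2 K`. -/
lemma LocalEstimates.abs_expansionError_le {hd : 2 ≤ d} (hΩ : IsAdmissibleDomain Ω)
    (hη : IsKernel η) (hρ : IsCkClosure 2 Ω ρ) (hφ : IsCkClosure 3 Ω φ)
    (hn : ContDiffOn ℝ 2 n Ω) {K ε : ℝ} {x : Space d}
    (h : LocalEstimates hd Ω η n K ε x) (hK : 1 ≤ K) (hε : 0 < ε) (hε1 : ε ≤ 1) (hx : x ∈ Ω)
    (hρx : ρ x ≠ 0) :
    |expansionError hd Ω ρ η n ε φ x| ≤
      (56 * K ^ 3 * η 0 * volume.real (ball (0 : Space d) 2) + 6 * K) * ckNorm 2 Ω ρ * ε *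
        ckNorm 3 Ω φ := by
  set N := ckNorm 3 Ω φ with hNdef
  set R := ckNorm 2 Ω ρ with hRdef
  set V := volume.real (ball (0 : Space d) 2) with hV
  have hN : 0 ≤ N := ckNorm_nonneg 3 Ω φ
  have hR : 0 ≤ R := ckNorm_nonneg 2 Ω ρ
  have hη0 := hη.zero_pos
  have hb := hΩ.isBounded
  have hDb := blowup_subset Ω ε x
  have hDm := (isOpen_blowup hΩ.isOpen ε x).measurableSet
  rw [expansionError_eq hd hΩ.isOpen hη hρ.1 hφ.1 hn hε hx hρx, h.sigma2_mul, map_zero, mul_zero,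
    add_zero]
  set Q := secondOrderForm ρ φ x with hQ
  set ℓ := fderiv ℝ φ x with hℓ
  set S := sigma1 hd η (bdryDist Ω x / ε) *
    ∑ i, Q (EuclideanSpace.single i 1) (EuclideanSpace.single i 1)
        + sigma2 hd η (bdryDist Ω x / ε) * Q (n x) (n x) with hS
  have hℓN : ‖ℓ‖ ≤ N := hφ.norm_fderiv_le hb (by norm_num) hx
  have hQN : ‖Q‖ ≤ 2 * R * N := norm_secondOrderForm_le hb hρ hφ hx
  have i1 := integrableOn_blowup hη hΩ hρ hφ ε x
  have i2 : IntegrableOn (fun z => η ‖z‖ * ℓ z) (blowup Ω ε x) :=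
    (hη.integrableOn_mul (by fun_prop)).mono_set hDb
  have i3 : IntegrableOn (fun z => η ‖z‖ * Q z z) (blowup Ω ε x) :=
    (hη.integrableOn_mul (by fun_prop)).mono_set hDb
  have i4 : IntegrableOn (fun z => η ‖z‖ * inner ℝ (n x) z) (blowup Ω ε x) :=
    (hη.integrableOn_mul (by fun_prop)).mono_set hDb
  set I := ∫ z in blowup Ω ε x, η ‖z‖ * ((φ x - φ (x + ε • z)) * ρ (x + ε • z)) with hI
  set I2 := ∫ z in blowup Ω ε x, η ‖z‖ * ℓ z with hI2
  set I3 := ∫ z in blowup Ω ε x, η ‖z‖ * Q z z with hI3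
  set I4 := ∫ z in blowup Ω ε x, η ‖z‖ * inner ℝ (n x) z with hI4
  have hrem : ∫ z in blowup Ω ε x, η ‖z‖ * ((φ x - φ (x + ε • z)) * ρ (x + ε • z) +
      ε * ρ x * ℓ z + ε ^ 2 * Q z z) = I + ε * ρ x * I2 + ε ^ 2 * I3 := by
    have i12 : IntegrableOn (fun z => η ‖z‖ * ((φ x - φ (x + ε • z)) * ρ (x + ε • z)) +
        ε * ρ x * (η ‖z‖ * ℓ z)) (blowup Ω ε x) := i1.add (i2.const_mul _)
    rw [hI, hI2, hI3, ← integral_const_mul, ← integral_const_mul,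
      ← integral_add i1 (i2.const_mul _), ← integral_add i12 (i3.const_mul _)]
    congr 1
    ext z
    ring
  have hremb : |I + ε * ρ x * I2 + ε ^ 2 * I3| ≤ η 0 * (28 * K ^ 3 * ε ^ 3 * N * R) * V := by
    rw [← hrem]
    exact abs_setIntegral_kernel_mul_le hη hDb
      (fun z hz => h.abs_remainder_le hΩ hρ hφ hK hε hε1 hx hz) (by positivity)
  have hfirst : |I2 - I4 * ℓ (n x)| ≤ K * ε ^ 2 * N := by
    have h1 := h.first_moment ℓ
    have h2 : ∫ z in blowup Ω ε x, η ‖z‖ * (ℓ z - inner ℝ (n x) z * ℓ (n x)) =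
        I2 - I4 * ℓ (n x) := by
      rw [hI2, hI4, ← integral_mul_const, ← integral_sub i2 (i4.mul_const _)]
      congr 1
      ext z
      ring
    rw [h2] at h1
    exact h1.trans (by gcongr)
  have hsecond : |I3 - S| ≤ K * ε * (2 * R * N) :=
    (h.second_moment Q).trans (by gcongr)
  have hP : |ρ x| ≤ R := hρ.abs_le hb hx
  -- The normal first moment cancels exactly, leaving the remainder, the second-moment error and the
  -- tangential first moment.
  have hE : 2 / ε ^ 2 * I + 2 * S + 2 * ρ x / ε * I4 * ℓ (n x) =
      2 / ε ^ 2 * (I + ε * ρ x * I2 + ε ^ 2 * I3) - 2 * (I3 - S) -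
        2 / ε * (ρ x * (I2 - I4 * ℓ (n x))) := by
    field_simp
    ring
  have t1 : |2 / ε ^ 2 * (I + ε * ρ x * I2 + ε ^ 2 * I3)| ≤
      56 * K ^ 3 * η 0 * V * R * ε * N := by
    rw [abs_mul, abs_of_pos (by positivity : 0 < 2 / ε ^ 2)]
    calc _ ≤ 2 / ε ^ 2 * (η 0 * (28 * K ^ 3 * ε ^ 3 * N * R) * V) := by gcongr
      _ = _ := by field_simp; ring
  have t2 : |2 / ε * (ρ x * (I2 - I4 * ℓ (n x)))| ≤ 2 * K * R * ε * N := by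
    rw [abs_mul, abs_mul, abs_of_pos (by positivity : 0 < 2 / ε)]
    calc _ ≤ 2 / ε * (R * (K * ε ^ 2 * N)) := by gcongr
      _ = _ := by field_simp
  rw [hE]
  have b1 := abs_le.1 t1
  have b2 := abs_le.1 t2
  have b3 := abs_le.1 hsecond
  rw [abs_le]
  constructor <;> linarith

lemma sq_apply_le_four {z : Space d} (hz : z ∈ ball (0 : Space d) 2) (i : Fin d) :
    z i ^ 2 ≤ 4 := by
  have h1 := PiLp.norm_apply_le z i
  rw [Real.norm_eq_abs] at h1
  have h2 := mem_ball_zero_iff.1 hz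
  rw [← sq_abs]
  nlinarith [abs_nonneg (z i)]

lemma IsKernel.abs_sigma1_le (hη : IsKernel η) (hd : 2 ≤ d) (t : ℝ) :
    |sigma1 hd η t| ≤ η 0 * 4 * volume.real (ball (0 : Space d) 2) :=
  abs_setIntegral_kernel_mul_le hη (lastHalfBall_subset hd t) (fun z hz => by
    rw [abs_of_nonneg (sq_nonneg _)]
    exact sq_apply_le_four (lastHalfBall_subset hd t hz) _) (by norm_num)

lemma IsKernel.abs_sigma2_le (hη : IsKernel η) (hd : 2 ≤ d) (t : ℝ) :
    |sigma2 hd η t| ≤ η 0 * 4 * volume.real (ball (0 : Space d) 2) :=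
  abs_setIntegral_kernel_mul_le hη (lastHalfBall_subset hd t) (fun z hz => by
    have h1 := sq_apply_le_four (lastHalfBall_subset hd t hz) (lastIdx hd)
    have h2 := sq_apply_le_four (lastHalfBall_subset hd t hz) (firstIdx hd)
    rw [abs_le]
    constructor <;> linarith [sq_nonneg (z (lastIdx hd)), sq_nonneg (z (firstIdx hd))])
    (by norm_num)

/-- The bound for scales that are bounded below. -/
lemma exists_abs_expansionError_le_of_le (hd : 2 ≤ d) (hΩ : IsAdmissibleDomain Ω)
    (hη : IsKernel η) (hρ : IsCkClosure 2 Ω ρ) (hρ0 : ∀ x ∈ Ω, ρ x ≠ 0)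
    (hn : IsNormalExtension Ω n) {ε₀ : ℝ} (hε₀ : 0 < ε₀) :
    ∃ C : ℝ, 0 ≤ C ∧ ∀ ε, ε₀ ≤ ε → ∀ φ, IsCkClosure 3 Ω φ → ∀ x ∈ Ω,
      |expansionError hd Ω ρ η n ε φ x| ≤ C * ε * ckNorm 3 Ω φ := by
  obtain ⟨M, hM, hnM⟩ := hn.exists_bound hΩ hd
  set R := ckNorm 2 Ω ρ with hRdef
  set V := volume.real (ball (0 : Space d) 2) with hV
  have hV0 : 0 ≤ V := measureReal_nonneg
  have hR : 0 ≤ R := ckNorm_nonneg 2 Ω ρ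
  have hη0 := hη.zero_pos
  have hb := hΩ.isBounded
  set σ := η 0 * 4 * V with hσ
  have hσ0 : 0 ≤ σ := by positivity
  set C := 2 / ε₀ ^ 2 * (η 0 * (2 * R) * V) + 2 * (σ * (d * (2 * R)) + σ * (2 * R * M ^ 2)) +
    2 * R / ε₀ * (η 0 * (M * 2) * V) * M + R * (σ * M) with hC
  have hC0 : 0 ≤ C := by positivity
  -- The error is at most `C` times the norm of `φ`, uniformly in `ε ≥ ε₀`; the missing factor `ε`
  -- is supplied by `ε / ε₀ ≥ 1`.
  refine ⟨C / ε₀, by positivity, fun ε hεε φ hφ x hx => ?_⟩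
  have hε : 0 < ε := hε₀.trans_le hεε
  set N := ckNorm 3 Ω φ with hNdef
  have hN : 0 ≤ N := ckNorm_nonneg 3 Ω φ
  suffices hsuff : |expansionError hd Ω ρ η n ε φ x| ≤ C * N by
    refine hsuff.trans (mul_le_mul_of_nonneg_right ?_ hN)
    rw [div_mul_eq_mul_div, le_div_iff₀ hε₀]
    gcongr
  obtain ⟨hn1, hn2⟩ := hnM x hx
  rw [expansionError_eq hd hΩ.isOpen hη hρ.1 hφ.1 hn.contDiffOn hε hx (hρ0 x hx)]
  set Q := secondOrderForm ρ φ x with hQ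
  set ℓ := fderiv ℝ φ x with hℓ
  set s1 := sigma1 hd η (bdryDist Ω x / ε) with hs1
  set s2 := sigma2 hd η (bdryDist Ω x / ε) with hs2
  have hs1b : |s1| ≤ σ := hη.abs_sigma1_le hd _
  have hs2b : |s2| ≤ σ := hη.abs_sigma2_le hd _
  have hℓN : ‖ℓ‖ ≤ N := hφ.norm_fderiv_le hb (by norm_num) hx
  have hQN : ‖Q‖ ≤ 2 * R * N := norm_secondOrderForm_le hb hρ hφ hx
  have hP : |ρ x| ≤ R := hρ.abs_le hb hx
  have hI : |∫ z in blowup Ω ε x, η ‖z‖ * ((φ x - φ (x + ε • z)) * ρ (x + ε • z))| ≤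
      η 0 * (2 * N * R) * V := by
    refine abs_setIntegral_kernel_mul_le hη (blowup_subset Ω ε x) (fun z hz => ?_) (by positivity)
    rw [abs_mul]
    have h1 : |φ x - φ (x + ε • z)| ≤ 2 * N := by
      refine (abs_sub _ _).trans ?_
      linarith [hφ.abs_le hb hx, hφ.abs_le hb hz.2]
    exact mul_le_mul h1 (hρ.abs_le hb hz.2) (abs_nonneg _) (by positivity)
  have hJ : |∫ z in blowup Ω ε x, η ‖z‖ * inner ℝ (n x) z| ≤ η 0 * (M * 2) * V := by
    refine abs_setIntegral_kernel_mul_le hη (blowup_subset Ω ε x) (fun z hz => ?_) (by positivity)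
    refine (abs_real_inner_le_norm _ _).trans ?_
    exact mul_le_mul hn1 (mem_ball_zero_iff.1 hz.1).le (norm_nonneg _) hM
  have hsum : |∑ i, Q (EuclideanSpace.single i 1) (EuclideanSpace.single i 1)| ≤
      d * (2 * R * N) := by
    refine (Finset.abs_sum_le_sum_abs _ _).trans ?_
    calc _ ≤ ∑ _i : Fin d, 2 * R * N := Finset.sum_le_sum fun i _ => by
          have := abs_bilin_self_le Q (z := EuclideanSpace.single i 1) (c := 1) (by simp)
          linarith
      _ = _ := by simp
  have hQn : |Q (n x) (n x)| ≤ 2 * R * N * M ^ 2 :=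
    (abs_bilin_self_le Q hn1).trans (by gcongr)
  have hℓn : |ℓ (n x)| ≤ N * M := (abs_clm_apply_le ℓ hn1).trans (by gcongr)
  have hℓD : |ℓ (fderiv ℝ n x (n x))| ≤ N * M := (abs_clm_apply_le ℓ hn2).trans (by gcongr)
  have t1 : |2 / ε ^ 2 * (∫ z in blowup Ω ε x,
      η ‖z‖ * ((φ x - φ (x + ε • z)) * ρ (x + ε • z)))| ≤
      2 / ε₀ ^ 2 * (η 0 * (2 * N * R) * V) := by
    rw [abs_mul, abs_of_pos (by positivity : 0 < 2 / ε ^ 2)]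
    gcongr
  have t2 : |s1 * ∑ i, Q (EuclideanSpace.single i 1) (EuclideanSpace.single i 1)| ≤
      σ * (d * (2 * R * N)) := by
    rw [abs_mul]; gcongr
  have t3 : |s2 * Q (n x) (n x)| ≤ σ * (2 * R * N * M ^ 2) := by
    rw [abs_mul]; gcongr
  have t4 : |2 * ρ x / ε * (∫ z in blowup Ω ε x, η ‖z‖ * inner ℝ (n x) z) * ℓ (n x)| ≤
      2 * R / ε₀ * (η 0 * (M * 2) * V) * (N * M) := by
    rw [abs_mul, abs_mul, abs_div, abs_mul, abs_of_pos hε, abs_of_pos (by norm_num : (0 : ℝ) < 2)]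
    gcongr
  have t5 : |ρ x * ℓ (s2 • fderiv ℝ n x (n x))| ≤ R * (σ * (N * M)) := by
    rw [map_smul, smul_eq_mul, abs_mul, abs_mul]
    gcongr
  have e : C * N = 2 / ε₀ ^ 2 * (η 0 * (2 * N * R) * V) + 2 * (σ * (d * (2 * R * N)) +
      σ * (2 * R * N * M ^ 2)) + 2 * R / ε₀ * (η 0 * (M * 2) * V) * (N * M) +
      R * (σ * (N * M)) := by
    rw [hC]; ring
  rw [e]
  rw [abs_le] at t1 t2 t3 t4 t5 ⊢
  constructor <;> linarith [t1.1, t1.2, t2.1, t2.2, t3.1, t3.2, t4.1, t4.2, t5.1, t5.2]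

theorem exists_abs_expansionError_le (hd : 2 ≤ d) (hΩ : IsAdmissibleDomain Ω)
    (hρ : IsAdmissibleDensity Ω ρ) (hη : IsKernel η) (hn : IsNormalExtension Ω n) :
    ∃ C : ℝ, 0 < C ∧ ∀ ε, 0 < ε → ∀ φ, IsCkClosure 3 Ω φ → ∀ x ∈ Ω,
      |expansionError hd Ω ρ η n ε φ x| ≤ C * ε * ckNorm 3 Ω φ := by
  have hρ0 : ∀ x ∈ Ω, ρ x ≠ 0 := by
    obtain ⟨m, hm, h⟩ := hρ.lower
    exact fun x hx => (hm.trans_le (h x hx)).ne'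
  obtain ⟨K₀, ε₁, hε₁, hbdry⟩ := hη.exists_localEstimates_boundary hd hΩ hn
  set K := max K₀ 1 with hKdef
  have hK : 1 ≤ K := le_max_right _ _
  set ε₀ := min ε₁ 1 with hε₀def
  have hε₀ : 0 < ε₀ := lt_min hε₁ one_pos
  obtain ⟨C, hC, hlarge⟩ := exists_abs_expansionError_le_of_le hd hΩ hη hρ.ck hρ0 hn hε₀
  have hR : 0 ≤ ckNorm 2 Ω ρ := ckNorm_nonneg 2 Ω ρ
  have hη0 := hη.zero_pos
  set C' := (56 * K ^ 3 * η 0 * volume.real (ball (0 : Space d) 2) + 6 * K) * ckNorm 2 Ω ρ with hC'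
  have hC'0 : 0 ≤ C' := by positivity
  refine ⟨max C C' + 1, by positivity, fun ε hε φ hφ x hx => ?_⟩
  have hN : 0 ≤ ckNorm 3 Ω φ := ckNorm_nonneg 3 Ω φ
  have hmono : ∀ c, c ≤ max C C' → c * ε * ckNorm 3 Ω φ ≤
      (max C C' + 1) * ε * ckNorm 3 Ω φ := fun c hc => by
    gcongr
    linarith
  -- Three regimes: `ε` bounded below, small `ε` with `x` at distance at least `2 ε` from the
  -- boundary, and small `ε` with `x` closer than that.
  rcases le_or_gt ε₀ ε with h1 | h1
  · exact (hlarge ε h1 φ hφ x hx).trans (hmono C (le_max_left _ _))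
  · have hest : LocalEstimates hd Ω η n K ε x := by
      rcases le_or_gt (2 * ε) (bdryDist Ω x) with h2 | h2
      · exact (hη.localEstimates_interior hd hΩ.isOpen hε hx h2 n).mono hε (le_max_right _ _)
      · exact (hbdry ε hε (h1.le.trans (min_le_left _ _)) x hx h2).mono hε (le_max_left _ _)
    exact (hest.abs_expansionError_le hΩ hη hρ.ck hφ hn.contDiffOn hK hε
      (h1.le.trans (min_le_right _ _)) hx (hρ0 x hx)).trans (hmono C' (le_max_right _ _))

end NonlocalLaplacian

theorem theorem3p2 {d : ℕ} (hd : 2 ≤ d)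
    (Ω : Set (NonlocalLaplacian.Space d)) (hΩ : NonlocalLaplacian.IsAdmissibleDomain Ω)
    (ρ : NonlocalLaplacian.Space d → ℝ) (hρ : NonlocalLaplacian.IsAdmissibleDensity Ω ρ)
    (η : ℝ → ℝ) (hη : NonlocalLaplacian.IsKernel η)
    (n : NonlocalLaplacian.Space d → NonlocalLaplacian.Space d)
    (hn : NonlocalLaplacian.IsNormalExtension Ω n) :
    ∃ C : ℝ, 0 < C ∧
      ∀ ε : ℝ, 0 < ε →
      ∀ φ : NonlocalLaplacian.Space d → ℝ, NonlocalLaplacian.IsCkClosure 3 Ω φ →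
      ∀ x ∈ Ω,
        |NonlocalLaplacian.nonlocalLaplacian Ω ρ η ε φ x
          - NonlocalLaplacian.sigma1 hd η (NonlocalLaplacian.bdryDist Ω x / ε)
              / NonlocalLaplacian.sigmaEta hd η
              * NonlocalLaplacian.weightedLaplacian hd ρ η φ x
          - 2 * ρ x * NonlocalLaplacian.gammaEps Ω η n ε x / ε
              * NonlocalLaplacian.normalDeriv n φ x
          + NonlocalLaplacian.sigma2 hd η (NonlocalLaplacian.bdryDist Ω x / ε) / ρ x
              * NonlocalLaplacian.normalDeriv n
                  (fun y => ρ y ^ 2 * NonlocalLaplacian.normalDeriv n φ y) x|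
          ≤ C * ε * NonlocalLaplacian.ckNorm 3 Ω φ := by
  exact NonlocalLaplacian.exists_abs_expansionError_le hd hΩ hρ hη hn
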